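/- Let $\Omega$ be a ranked alphabet that contains at least one symbol of rank $0$ and is effectively given (its symbols are coded by natural numbers, and the rank is computable from the symbol). Values are the ground terms over $\Omega$. A \emph{program} over $\Omega$ consists of a finite set $\mathbf X$ of global variables and a finite set of parameterless procedures, one of them called \emph{main}. Each procedure is given by a finite control flow graph with a start point and a return point, whose edges are labelled by a non-deterministic assignment $\mathbf x = {?}$ of an arbitrary value, by an assignment $\mathbf x = t$ where $t$ is a term over $\Omega$ and $\mathbf X$ in which at most one variable occurs (possibly several times), or by a procedure call $q()$; procedures may be recursive. Execution begins at the start point of \emph{main} in an arbitrary state $\sigma$ (a map from $\mathbf X$ to values). Let $R$ be the set of ground right-hand sides of assignments of the program, and let $G$ be the set of ground subterms of its non-ground right-hand sides of assignments. The program is \emph{initialization-restricted} (IR) if $R\cap G=\emptyset$ and if, for all $r_1,r_2\in R$, $r_1$ is a subterm of $r_2$ only if $r_1=r_2$. A \emph{two-variable equality} is an equality $s\doteq t$ of terms over $\Omega$ and $\mathbf X$ such that at most one variable occurs in $s$ and at most one variable occurs in $t$ (each possibly several times); this includes the constant equalities $\mathbf x\doteq t$ with $t$ ground. A state satisfies $s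 \doteq t$ if both sides have the same value in it, and $s\doteq t$ is \emph{valid} at a program point $u$ if it is satisfied by every state with which some execution reaches $u$. \textbf{Theorem.} For IR programs, the set of all two-variable equalities that are valid at a program point can be effectively determined. That is: \begin{enumerate} \item There is an algorithm that, given any IR program $p$ over $\Omega$ and any program point $u$ of $p$, halts and outputs a finite list $B$ of two-variable equalities such that a two-variable equality $e$ is valid at $u$ if and only if every state that satisfies all equalities in $B$ satisfies $e$. \item There is an algorithm that, given any IR program $p$ over $\Omega$, any program point $u$ of $p$ and any two-variable equality $e$, halts and decides whether $e$ is valid at $u$. \end{enumerate} -/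

import Mathlib

/-! Herbrand programs.  A ranked alphabet is a first-order language `Ω` of Mathlib, of which only the
function symbols are used: `Ω.Functions k` is the set of constructors of rank `k`.  Terms over `Ω`
with variables in `V` are `Ω.Term V`, and ground terms are `Ω.Term Empty`. -/

namespace Herbrand

variable {Ω : FirstOrder.Language.{0, 0}} {n m : ℕ}

/-- The values that programs compute with: ground terms. -/
abbrev Value (Ω : FirstOrder.Language.{0, 0}) : Type := Ω.Term Empty

/-- A program state assigns a value to each of the `n` program variables. -/
abbrev State (Ω : FirstOrder.Language.{0, 0}) (n : ℕ) : Type := Fin n → Value Ω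

/-- The value of a term in a state. -/
def eval (σ : State Ω n) (t : Ω.Term (Fin n)) : Value Ω := t.subst σ

/-- A term is ground if no variable occurs in it. -/
def IsGround (t : Ω.Term (Fin n)) : Prop := t.varFinset = ∅

/-- At most one variable occurs in the term (arbitrarily many times). -/
def AtMostOneVar (t : Ω.Term (Fin n)) : Prop := t.varFinset.card ≤ 1

/-- `Subterm s t`: the term `s` occurs in `t` (possibly `s = t`). -/
inductive Subterm : Ω.Term (Fin n) → Ω.Term (Fin n) → Prop
  | refl (t : Ω.Term (Fin n)) : Subterm t t
  | func {k : ℕ} (f : Ω.Functions k) (ts : Fin k → Ω.Term (Fin n)) (i : Fin k)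
      {s : Ω.Term (Fin n)} (h : Subterm s (ts i)) : Subterm s (FirstOrder.Language.Term.func f ts)

/-- Basic statements of programs with `n` variables and `m` procedures. -/
inductive Stmt (Ω : FirstOrder.Language.{0, 0}) (n m : ℕ) : Type
  /-- `x = ?` : assign an arbitrary value to `x`. -/
  | havoc (x : Fin n) : Stmt Ω n m
  /-- `x = t` -/
  | assign (x : Fin n) (t : Ω.Term (Fin n)) : Stmt Ω n m
  /-- `q()` -/
  | call (q : Fin m) : Stmt Ω n m

/-- A program: finitely many parameterless procedures, which operate on finitely many global
variables, each procedure being given by its control flow graph.  The right-hand side of each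
assignment contains at most one variable. -/
structure Program (Ω : FirstOrder.Language.{0, 0}) where
  numVars : ℕ
  numProcs : ℕ
  numPoints : ℕ
  main : Fin numProcs
  /-- the procedure that a program point belongs to -/
  procOf : Fin numPoints → Fin numProcs
  /-- the start point of a procedure -/
  start : Fin numProcs → Fin numPoints
  /-- the return point of a procedure -/
  ret : Fin numProcs → Fin numPoints
  edges : List (Fin numPoints × Stmt Ω numVars numProcs × Fin numPoints)
  procOf_start : ∀ q, procOf (start q) = q
  procOf_ret : ∀ q, procOf (ret q) = q
  procOf_edge : ∀ u s v, (u, s, v) ∈ edges → procOf u = procOf v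
  atMostOneVar : ∀ u x t v, (u, Stmt.assign x t, v) ∈ edges → AtMostOneVar t

namespace Program

variable (p : Program Ω)

/-- `p.SameLevel u σ v τ`: some execution leads from point `u` with state `σ` to point `v` of the
same procedure with state `τ`, and all procedures called in between have returned. -/
inductive SameLevel : Fin p.numPoints → State Ω p.numVars →
    Fin p.numPoints → State Ω p.numVars → Prop
  | refl (u σ) : SameLevel u σ u σ
  | havoc {u σ v τ x w} (c : Value Ω) (h : SameLevel u σ v τ)
      (he : (v, Stmt.havoc x, w) ∈ p.edges) : SameLevel u σ w (Function.update τ x c)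
  | assign {u σ v τ x t w} (h : SameLevel u σ v τ)
      (he : (v, Stmt.assign x t, w) ∈ p.edges) : SameLevel u σ w (Function.update τ x (eval τ t))
  | call {u σ v τ q w ρ} (h : SameLevel u σ v τ) (he : (v, Stmt.call q, w) ∈ p.edges)
      (hq : SameLevel (p.start q) τ (p.ret q) ρ) : SameLevel u σ w ρ

/-- `p.Reaches u σ`: some execution of the program, started at the start point of `main` in an
arbitrary state, reaches the program point `u` with state `σ`. -/
inductive Reaches : Fin p.numPoints → State Ω p.numVars → Prop
  | init (σ) : Reaches (p.start p.main) σ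
  | havoc {u σ x v} (c : Value Ω) (h : Reaches u σ)
      (he : (u, Stmt.havoc x, v) ∈ p.edges) : Reaches v (Function.update σ x c)
  | assign {u σ x t v} (h : Reaches u σ)
      (he : (u, Stmt.assign x t, v) ∈ p.edges) : Reaches v (Function.update σ x (eval σ t))
  | enter {u σ q v} (h : Reaches u σ)
      (he : (u, Stmt.call q, v) ∈ p.edges) : Reaches (p.start q) σ
  | call {u σ q v τ} (h : Reaches u σ) (he : (u, Stmt.call q, v) ∈ p.edges)
      (hq : p.SameLevel (p.start q) σ (p.ret q) τ) : Reaches v τ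

/-- The right-hand sides of the assignments of the program. -/
def rhs : Set (Ω.Term (Fin p.numVars)) :=
  {t | ∃ u x v, (u, Stmt.assign x t, v) ∈ p.edges}

/-- The set `R` of ground right-hand sides. -/
def groundRhs : Set (Ω.Term (Fin p.numVars)) := {t | t ∈ p.rhs ∧ IsGround t}

/-- The set `G` of ground subterms of non-ground right-hand sides. -/
def groundSubterms : Set (Ω.Term (Fin p.numVars)) :=
  {s | IsGround s ∧ ∃ t ∈ p.rhs, ¬ IsGround t ∧ Subterm s t}

/-- Initialization-restricted programs. -/
def InitRestricted : Prop :=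
  Disjoint p.groundRhs p.groundSubterms ∧
    ∀ r₁ ∈ p.groundRhs, ∀ r₂ ∈ p.groundRhs, Subterm r₁ r₂ → r₁ = r₂

end Program

/-- A (Herbrand) equality `lhs ≐ rhs` between terms over the program variables. -/
structure Equality (Ω : FirstOrder.Language.{0, 0}) (n : ℕ) where
  lhs : Ω.Term (Fin n)
  rhs : Ω.Term (Fin n)

namespace Equality

/-- A state satisfies an equality if both sides have the same value in it. -/
def Holds (σ : State Ω n) (e : Equality Ω n) : Prop := eval σ e.lhs = eval σ e.rhs

/-- Two-variable equalities: each side contains at most one variable (arbitrarily many times).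
Thus the equalities `s x ≐ t y` with templates `s`, `t` are included, and so are `s x ≐ t` and
`s ≐ t y` with a ground side, in particular the constant equalities `x ≐ t`. -/
def IsTwoVar (e : Equality Ω n) : Prop := AtMostOneVar e.lhs ∧ AtMostOneVar e.rhs

/-- The conjunction of `B` subsumes `e`: every state that satisfies all of `B` satisfies `e`. -/
def Subsumes (B : List (Equality Ω n)) (e : Equality Ω n) : Prop :=
  ∀ σ : State Ω n, (∀ b ∈ B, b.Holds σ) → e.Holds σ

end Equality

/-- The equality `e` is valid when reaching the program point `u`. -/
def Program.ValidAt (p : Program Ω) (u : Fin p.numPoints) (e : Equality Ω p.numVars) : Prop :=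
  ∀ σ, p.Reaches u σ → e.Holds σ

/-! Presentation of programs and equalities as finite words, as input and output of algorithms. -/

/-- The type of all constructors, of any rank. -/
abbrev Sym (Ω : FirstOrder.Language.{0, 0}) : Type := Σ k, Ω.Functions k

/-- Terms are written in Polish notation, with variables numbered by natural numbers. -/
abbrev TermCode (Ω : FirstOrder.Language.{0, 0}) : Type := List (ℕ ⊕ Sym Ω)

abbrev EqCode (Ω : FirstOrder.Language.{0, 0}) : Type := TermCode Ω × TermCode Ω

abbrev StmtCode (Ω : FirstOrder.Language.{0, 0}) : Type := ℕ ⊕ (ℕ × TermCode Ω) ⊕ ℕ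

/-- Number of variables, number of the main procedure, the list of the start and return points of
the procedures, the list of the procedures that the program points belong to, the edges. -/
abbrev ProgCode (Ω : FirstOrder.Language.{0, 0}) : Type :=
  ℕ × ℕ × List (ℕ × ℕ) × List ℕ × List (ℕ × StmtCode Ω × ℕ)

def termCode (t : Ω.Term (Fin n)) : TermCode Ω := t.listEncode.map (Sum.map Fin.val id)

def Equality.code (e : Equality Ω n) : EqCode Ω := (termCode e.lhs, termCode e.rhs)

def Stmt.code : Stmt Ω n m → StmtCode Ω
  | .havoc x => .inl x
  | .assign x t => .inr (.inl (x, termCode t))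
  | .call q => .inr (.inr q)

def Program.code (p : Program Ω) : ProgCode Ω :=
  (p.numVars, p.main,
    List.ofFn (fun q => ((p.start q : ℕ), (p.ret q : ℕ))),
    List.ofFn (fun u => (p.procOf u : ℕ)),
    p.edges.map (fun e => ((e.1 : ℕ), e.2.1.code, (e.2.2 : ℕ))))

end Herbrand

/-!
The value of a variable after an execution is a term in the initial values and in the values chosen
by non-deterministic assignments. So an equality `s ≐ t` is valid at a program point if and only if
its two sides have the same weakest precondition `wp l s = wp l t` for every list `l` of assignments
that is executed by some run to this point, unless there is only one value and everything is valid
(`Program.validAt_iff`). Two variables suffice to stand for the non-deterministic choices. The runs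
are generated by derivations, with summaries of procedure calls, and `level` collects those with a
derivation of bounded height; so everything depends on a computable bound on the height of the runs
that have to be inspected.

In an initialization-restricted program, the variables and the ground right-hand sides form an
antichain `O` for the subterm relation, and the templates of the other right-hand sides have no
ground subterm in `O`. Hence every value that is reached has the form `w o` with a product `w` of
templates and `o ∈ O`, where `w` and `o` are unique (`plug_unique`). Templates form a free monoid
under composition (`plug_levi`, `Template.factors_mul`). Write the irreducible factors of `w`,
followed by `o`, as the digits of a number: then every value is encoded injectively by a number, and
every template acts on these numbers as an affine map (`exists_affine_code`). So a run acts on the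
vector of the encoded variables as a matrix.

After equal function symbols are removed from the roots of both sides, an equality has the form
`x ≐ t`. If `t` is ground or its template has no ground subterm in `O`, then the equality says that
one linear form vanishes on the vector, or that `x` has a value that is never reached. If some ground
subterm of the template of `t` belongs to `O`, then `x ≐ t` forces `x` into a finite set of values
of bounded size, and an equality that is violated by some run is refuted by a product of linear
forms (`Admissible.exists_short_of_ne_not_avoiding`). A product of `J` linear forms is a linear form
in the `J`-th Kronecker power of the matrices. The spans of the Kronecker powers of the matrices of
runs up to a given height are an ascending chain, and it is constant once it repeats; therefore a
violation by some run entails a violation by a run whose height is bounded in terms of dimensions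
(`exists_short_of_prod_ne_zero`, `Program.validAt_iff_bounded`). This decides validity.

A basis of all valid equalities is computed from a single run `l` to the program point. A valid
equality `x ≐ t` satisfies `wp l t = wp l x`, so `t` is not longer than `wp l x` and consists of one
variable and symbols of `wp l x`. There are finitely many such `t`, and the ones that pass the test
are collected. They entail every valid equality, because a valid equality whose sides are both not
variables splits into valid equalities between the arguments (`holds_of_solved`). If there is no
run, an unsatisfiable equality is a basis.

The algorithms work on words in Polish notation and are primitive recursive.
-/

namespace Herbrand
open FirstOrder.Language.Term (var func)

variable {Ω : FirstOrder.Language.{0, 0}} {α β γ : Type}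

/-! ### Terms, occurrences and substitution -/

/-- The variable `a` occurs in the term. -/
def Occurs (a : α) : Ω.Term α → Prop
  | .var b => b = a
  | .func _ ts => ∃ i, Occurs a (ts i)

@[simp] lemma occurs_var {a b : α} : Occurs a (var b : Ω.Term α) ↔ b = a := Iff.rfl

@[simp] lemma occurs_func {a : α} {k : ℕ} {f : Ω.Functions k} {ts : Fin k → Ω.Term α} :
    Occurs a (func f ts) ↔ ∃ i, Occurs a (ts i) := Iff.rfl

lemma mem_varFinset [DecidableEq α] {a : α} {t : Ω.Term α} : a ∈ t.varFinset ↔ Occurs a t := by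
  induction t with
  | var b => simp [FirstOrder.Language.Term.varFinset, eq_comm]
  | func f ts ih => simp [FirstOrder.Language.Term.varFinset, ih]

lemma subst_congr {t : Ω.Term α} {σ τ : α → Ω.Term β} (h : ∀ a, Occurs a t → σ a = τ a) :
    t.subst σ = t.subst τ := by
  induction t with
  | var a => exact h a rfl
  | func f ts ih =>
    simp only [FirstOrder.Language.Term.subst]
    congr 1
    funext i
    exact ih i fun a ha => h a ⟨i, ha⟩

lemma subst_subst (t : Ω.Term α) (σ : α → Ω.Term β) (τ : β → Ω.Term γ) :
    (t.subst σ).subst τ = t.subst fun a => (σ a).subst τ := by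
  induction t with
  | var a => rfl
  | func f ts ih => simp [FirstOrder.Language.Term.subst, ih]

lemma subst_var (t : Ω.Term α) : t.subst var = t := by
  induction t with
  | var a => rfl
  | func f ts ih => simp [FirstOrder.Language.Term.subst, ih]

lemma relabel_eq_subst (t : Ω.Term α) (g : α → β) : t.relabel g = t.subst fun a => var (g a) := by
  induction t with
  | var a => rfl
  | func f ts ih => simp [FirstOrder.Language.Term.subst, ih]

lemma occurs_subst {t : Ω.Term α} {σ : α → Ω.Term β} {b : β} :
    Occurs b (t.subst σ) ↔ ∃ a, Occurs a t ∧ Occurs b (σ a) := by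
  induction t with
  | var a => simp [FirstOrder.Language.Term.subst]
  | func f ts ih =>
    simp only [FirstOrder.Language.Term.subst, occurs_func, ih]
    exact ⟨fun ⟨i, a, h, h'⟩ => ⟨a, ⟨i, h⟩, h'⟩, fun ⟨a, ⟨i, h⟩, h'⟩ => ⟨i, a, h, h'⟩⟩

lemma occurs_relabel {t : Ω.Term α} {g : α → β} {b : β} :
    Occurs b (t.relabel g) ↔ ∃ a, Occurs a t ∧ g a = b := by
  simp [relabel_eq_subst, occurs_subst]

lemma func_inj {k : ℕ} {f g : Ω.Functions k} {ts us : Fin k → Ω.Term α}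
    (h : func f ts = func g us) : f = g ∧ ts = us := by
  simpa using h

/-- A relabelling that is injective on the variables of two terms reflects equality. -/
lemma relabel_injOn {s t : Ω.Term α} {g : α → β}
    (hg : ∀ a b, (Occurs a s ∨ Occurs a t) → (Occurs b s ∨ Occurs b t) → g a = g b → a = b)
    (h : s.relabel g = t.relabel g) : s = t := by
  induction s generalizing t with
  | var a =>
    cases t with
    | var b =>
      simp only [FirstOrder.Language.Term.relabel, FirstOrder.Language.Term.var.injEq] at h
      rw [hg a b (.inl rfl) (.inr rfl) h]
    | func g us => simp at h
  | func f ts ih =>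
    cases t with
    | var b => simp at h
    | func g us =>
      simp only [FirstOrder.Language.Term.relabel, FirstOrder.Language.Term.func.injEq] at h
      obtain ⟨rfl, h⟩ := h
      simp only [heq_eq_eq] at h
      obtain ⟨rfl, h⟩ := h
      congr 1
      funext i
      refine ih i (fun a b ha hb => hg a b ?_ ?_) (congrFun h i)
      · exact ha.imp (fun h => ⟨i, h⟩) (fun h => ⟨i, h⟩)
      · exact hb.imp (fun h => ⟨i, h⟩) (fun h => ⟨i, h⟩)

/-- The number of nodes of a term, that is, the length of its Polish notation. -/
def size (t : Ω.Term α) : ℕ := t.listEncode.length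

lemma size_func {k : ℕ} (f : Ω.Functions k) (ts : Fin k → Ω.Term α) :
    size (func f ts) = (∑ i, size (ts i)) + 1 := by
  simp [size, FirstOrder.Language.Term.listEncode, List.length_flatMap, ← List.ofFn_eq_map,
    List.sum_ofFn]

lemma size_pos (t : Ω.Term α) : 0 < size t := by
  cases t with
  | var a => simp [size, FirstOrder.Language.Term.listEncode]
  | func f ts => rw [size_func]; omega

lemma size_lt_func {k : ℕ} (f : Ω.Functions k) (ts : Fin k → Ω.Term α) (i : Fin k) :
    size (ts i) < size (func f ts) := by
  rw [size_func]
  have := Finset.single_le_sum (f := fun i => size (ts i)) (fun _ _ => Nat.zero_le _)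
    (Finset.mem_univ i)
  omega

lemma size_le_subst {t : Ω.Term α} {a : α} (h : Occurs a t) (σ : α → Ω.Term β) :
    size (σ a) ≤ size (t.subst σ) := by
  induction t with
  | var b => obtain rfl := h; exact le_rfl
  | func f ts ih =>
    obtain ⟨i, hi⟩ := h
    exact (ih i hi).trans (size_lt_func f (fun i => (ts i).subst σ) i).le

lemma size_lt_subst {t : Ω.Term α} {a : α} (h : Occurs a t) (ht : t ≠ var a)
    (σ : α → Ω.Term β) : size (σ a) < size (t.subst σ) := by
  cases t with
  | var b => obtain rfl := h; exact absurd rfl ht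
  | func f ts =>
    obtain ⟨i, hi⟩ := h
    exact (size_le_subst hi σ).trans_lt (size_lt_func f (fun i => (ts i).subst σ) i)

/-- In Polish notation, substitution replaces each variable by the word of its image. -/
lemma listEncode_subst (t : Ω.Term α) (σ : α → Ω.Term β) :
    (t.subst σ).listEncode = t.listEncode.flatMap
      (Sum.elim (fun a => (σ a).listEncode) fun f => [Sum.inr f]) := by
  induction t with
  | var a => simp [FirstOrder.Language.Term.subst, FirstOrder.Language.Term.listEncode]
  | func f ts ih =>
    simp only [FirstOrder.Language.Term.subst, FirstOrder.Language.Term.listEncode, ih,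
      List.flatMap_cons, Sum.elim_inr, List.flatMap_assoc, List.singleton_append]

/-- `SubAt d s t`: the term `s` is the subterm of `t` at some position of depth `d`. -/
inductive SubAt : ℕ → Ω.Term α → Ω.Term α → Prop
  | refl (t : Ω.Term α) : SubAt 0 t t
  | func {d k : ℕ} (f : Ω.Functions k) (ts : Fin k → Ω.Term α) (i : Fin k)
      {s : Ω.Term α} (h : SubAt d s (ts i)) : SubAt (d + 1) s (func f ts)

namespace SubAt

lemma trans {d e : ℕ} {r s t : Ω.Term α} (h : SubAt d r s) (h' : SubAt e s t) :
    SubAt (d + e) r t := by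
  induction h' with
  | refl => exact h
  | func f ts i _ ih => exact .func f ts i (ih h)

lemma add_size_le {d : ℕ} {s t : Ω.Term α} (h : SubAt d s t) : d + size s ≤ size t := by
  induction h with
  | refl => simp
  | func f ts i _ ih => have := size_lt_func f ts i; omega

lemma occurs {d : ℕ} {s t : Ω.Term α} (h : SubAt d s t) {a : α} (ha : Occurs a s) :
    Occurs a t := by
  induction h with
  | refl => exact ha
  | func f ts i _ ih => exact ⟨i, ih ha⟩

lemma subst {d : ℕ} {s t : Ω.Term α} (h : SubAt d s t) (σ : α → Ω.Term β) :
    SubAt d (s.subst σ) (t.subst σ) := by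
  induction h with
  | refl => exact .refl _
  | func f ts i _ ih => exact .func f (fun i => (ts i).subst σ) i ih

lemma of_occurs {t : Ω.Term α} {a : α} (h : Occurs a t) : ∃ d, SubAt d (var a) t := by
  induction t with
  | var b => obtain rfl := h; exact ⟨0, .refl _⟩
  | func f ts ih =>
    obtain ⟨i, hi⟩ := h
    obtain ⟨d, hd⟩ := ih i hi
    exact ⟨d + 1, .func f ts i hd⟩

lemma of_relabel {d : ℕ} {s : Ω.Term β} {t : Ω.Term α} {g : α → β} (h : SubAt d s (t.relabel g)) :
    ∃ s', SubAt d s' t ∧ s = s'.relabel g := by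
  induction t generalizing d with
  | var a =>
    cases h
    exact ⟨_, .refl _, rfl⟩
  | func f ts ih =>
    simp only [FirstOrder.Language.Term.relabel] at h
    cases h with
    | refl => exact ⟨_, .refl _, rfl⟩
    | func _ _ i h =>
      obtain ⟨s', h', rfl⟩ := ih i h
      exact ⟨s', .func f ts i h', rfl⟩

lemma subterm {n d : ℕ} {s t : Ω.Term (Fin n)} (h : SubAt d s t) : Subterm s t := by
  induction h with
  | refl => exact .refl _
  | func f ts i _ ih => exact .func f ts i ih

end SubAt

/-- If ground values are not all equal, distinct terms have distinct values under some ground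
substitution. -/
lemma exists_subst_ne {c d : Ω.Term β} (hcd : c ≠ d) {s t : Ω.Term α} (h : s ≠ t) :
    ∃ θ : α → Ω.Term β, s.subst θ ≠ t.subst θ := by
  classical
  -- a variable and a different term
  have key : ∀ (a : α) (t : Ω.Term α), var a ≠ t →
      ∃ θ : α → Ω.Term β, θ a ≠ t.subst θ := by
    intro a t h
    by_cases ha : Occurs a t
    · exact ⟨fun _ => c, fun h' =>
        absurd (congrArg size h') (size_lt_subst ha (Ne.symm h) fun _ => c).ne⟩
    · have hu : ∀ v, t.subst (Function.update (fun _ => c) a v) = t.subst fun _ => c :=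
        fun v => subst_congr fun b hb => Function.update_of_ne (by rintro rfl; exact ha hb) _ _
      by_cases hc : c = t.subst fun _ => c
      · exact ⟨Function.update (fun _ => c) a d, by
          rw [hu, Function.update_self, ← hc]; exact hcd.symm⟩
      · exact ⟨Function.update (fun _ => c) a c, by rwa [hu, Function.update_self]⟩
  induction s generalizing t with
  | var a => exact key a t h
  | func f ts ih =>
    cases t with
    | var a => exact (key a _ h.symm).imp fun θ h => h.symm
    | @func k g us =>
      rename_i l
      by_cases hk : k = l
      · subst hk
        by_cases hf : f = g
        · subst hf
          have : ∃ i, ts i ≠ us i := by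
            by_contra! hc
            exact h (congrArg _ (funext hc))
          obtain ⟨i, hi⟩ := this
          obtain ⟨θ, hθ⟩ := ih i hi
          exact ⟨θ, fun e => hθ (congrFun (func_inj e).2 i)⟩
        · exact ⟨fun _ => c, fun e => hf (func_inj e).1⟩
      · refine ⟨fun _ => c, fun e => hk ?_⟩
        simp only [FirstOrder.Language.Term.subst, FirstOrder.Language.Term.func.injEq] at e
        exact e.1.symm

end Herbrand

namespace Herbrand
open FirstOrder.Language.Term (var func)

variable {Ω : FirstOrder.Language.{0, 0}} {α β γ : Type}

/-! ### Templates -/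

/-- The term obtained from `w` by putting `v` into the hole, the unique variable of `w`. -/
def plug (w : Ω.Term Unit) (v : Ω.Term α) : Ω.Term α := w.subst fun _ => v

@[simp] lemma plug_var (v : Ω.Term α) : plug (var ()) v = v := rfl

@[simp] lemma plug_func {k : ℕ} (f : Ω.Functions k) (ts : Fin k → Ω.Term Unit) (v : Ω.Term α) :
    plug (func f ts) v = func f fun i => plug (ts i) v := rfl

lemma plug_hole (w : Ω.Term Unit) : plug w (var ()) = w := subst_var w

lemma plug_plug (w w' : Ω.Term Unit) (v : Ω.Term α) :
    plug (plug w w') v = plug w (plug w' v) := subst_subst _ _ _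

lemma plug_congr_of_ground {w : Ω.Term Unit} (h : ¬ Occurs () w) (v v' : Ω.Term α) :
    plug w v = plug w v' := subst_congr fun _ ha => absurd ha h

lemma plug_injective {w : Ω.Term Unit} (h : Occurs () w) {v v' : Ω.Term α}
    (e : plug w v = plug w v') : v = v' := by
  induction w with
  | var => exact e
  | func f ts ih =>
    obtain ⟨i, hi⟩ := h
    exact ih i hi (congrFun (func_inj e).2 i)

lemma size_lt_plug {w : Ω.Term Unit} (h : Occurs () w) (hw : w ≠ var ()) (v : Ω.Term α) :
    size v < size (plug w v) := size_lt_subst h hw fun _ => v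

lemma occurs_plug {w : Ω.Term Unit} {v : Ω.Term α} {a : α} :
    Occurs a (plug w v) ↔ Occurs () w ∧ Occurs a v := by
  simp only [plug, occurs_subst]
  exact ⟨fun ⟨_, h, h'⟩ => ⟨h, h'⟩, fun ⟨h, h'⟩ => ⟨(), h, h'⟩⟩

lemma exists_subAt_plug {w : Ω.Term Unit} (h : Occurs () w) (v : Ω.Term α) :
    ∃ d, SubAt d v (plug w v) := by
  obtain ⟨d, hd⟩ := SubAt.of_occurs h
  exact ⟨d, hd.subst fun _ => v⟩

/-- `O` is a set of terms none of which is a proper subterm of another one. -/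
def SubtermAntichain (O : Set (Ω.Term α)) : Prop :=
  ∀ o ∈ O, ∀ o' ∈ O, ∀ d, SubAt d o o' → o = o'

/-- No ground subterm of the template `w` belongs to `O`. -/
def Avoids (O : Set (Ω.Term α)) (w : Ω.Term Unit) : Prop :=
  ∀ d s, SubAt d s w → ¬ Occurs () s → ∀ v : Ω.Term α, plug s v ∉ O

lemma Avoids.arg {O : Set (Ω.Term α)} {k : ℕ} {f : Ω.Functions k} {ts : Fin k → Ω.Term Unit}
    (h : Avoids O (func f ts)) (i : Fin k) : Avoids O (ts i) :=
  fun d s hs => h (d + 1) s (.func f ts i hs)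

lemma avoids_var {O : Set (Ω.Term α)} : Avoids O (var ()) := by
  rintro d s hs hg
  cases hs
  exact absurd rfl hg

/-- If `s` has no hole and equals a template filled with `o`, then `o` is a subterm of `s`. -/
lemma exists_ground_subAt {s w : Ω.Term Unit} (hs : ¬ Occurs () s) (hw : Occurs () w)
    {v o : Ω.Term α} (h : plug s v = plug w o) :
    ∃ d s', SubAt d s' s ∧ ¬ Occurs () s' ∧ plug s' v = o := by
  induction w generalizing s with
  | var => exact ⟨0, s, .refl s, hs, h⟩
  | func f ts ih =>
    obtain ⟨i, hi⟩ := hw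
    cases s with
    | var => exact absurd rfl hs
    | func g us =>
      simp only [plug_func, FirstOrder.Language.Term.func.injEq] at h
      obtain ⟨rfl, h⟩ := h
      simp only [heq_eq_eq] at h
      obtain ⟨d, s', h1, h2, h3⟩ := ih i (fun hc => hs ⟨i, hc⟩) hi (congrFun h.2 i)
      exact ⟨d + 1, s', .func _ _ i h1, h2, h3⟩

/-- Values built by templates that avoid an antichain `O` from elements of `O` determine both the
template and the element. -/
theorem plug_unique {O : Set (Ω.Term α)} (hO : SubtermAntichain O) {w w' : Ω.Term Unit}
    (hw : Occurs () w) (hw' : Occurs () w') (hg : Avoids O w) (hg' : Avoids O w')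
    {o o' : Ω.Term α} (ho : o ∈ O) (ho' : o' ∈ O) (h : plug w o = plug w' o') :
    w = w' ∧ o = o' := by
  -- a hole that lies on top of the other filled template
  have key : ∀ {w : Ω.Term Unit}, Occurs () w → ∀ {o o' : Ω.Term α}, o ∈ O → o' ∈ O →
      o = plug w o' → var () = w ∧ o = o' := by
    intro w hw o o' ho ho' h
    obtain ⟨d, hd⟩ := exists_subAt_plug hw o'
    rw [← h] at hd
    obtain rfl := hO _ ho' _ ho d hd
    refine ⟨?_, rfl⟩
    by_contra hc
    exact (size_lt_plug hw (Ne.symm hc) o').ne (congrArg size h)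
  induction w generalizing w' with
  | var => exact key hw' ho ho' h
  | func f ts ih =>
    cases w' with
    | var =>
      obtain ⟨h1, h2⟩ := key hw ho' ho h.symm
      exact ⟨h1.symm, h2.symm⟩
    | func g us =>
      simp only [plug_func, FirstOrder.Language.Term.func.injEq] at h
      obtain ⟨rfl, h⟩ := h
      simp only [heq_eq_eq] at h
      obtain ⟨rfl, h⟩ := h
      have hi : ∀ i, (ts i = us i) ∧ (Occurs () (ts i) → o = o') := by
        intro i
        have h := congrFun h i
        by_cases h1 : Occurs () (ts i) <;> by_cases h2 : Occurs () (us i)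
        · obtain ⟨e, e'⟩ := ih i h1 h2 (hg.arg i) (hg'.arg i) h
          exact ⟨e, fun _ => e'⟩
        · obtain ⟨d, s', e1, e2, e3⟩ := exists_ground_subAt h2 h1 h.symm
          exact absurd (e3 ▸ ho) (hg'.arg i d s' e1 e2 _)
        · obtain ⟨d, s', e1, e2, e3⟩ := exists_ground_subAt h1 h2 h
          exact absurd (e3 ▸ ho') (hg.arg i d s' e1 e2 _)
        · refine ⟨?_, fun hc => absurd hc h1⟩
          refine relabel_injOn (g := fun _ : Unit => (Sum.inl () : Unit ⊕ α))
            (fun a b _ _ _ => rfl) ?_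
          have := congrArg (fun t => t.relabel (Sum.inr : α → Unit ⊕ α)) h
          simp only [relabel_eq_subst, plug, subst_subst] at this ⊢
          rw [subst_congr (t := ts i) (τ := fun _ => o.subst fun a => var (Sum.inr a)),
            subst_congr (t := us i) (τ := fun _ => o'.subst fun a => var (Sum.inr a))]
          · exact this
          · exact fun a ha => absurd ha h2
          · exact fun a ha => absurd ha h1
      obtain ⟨i, hi'⟩ := hw
      exact ⟨congrArg _ (funext fun i => (hi i).1), (hi i).2 hi'⟩

lemma plug_right_cancel {w w' v : Ω.Term Unit} (hw : Occurs () w) (hw' : Occurs () w')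
    (hv : Occurs () v) (h : plug w v = plug w' v) : w = w' := by
  have hav : ∀ w : Ω.Term Unit, Avoids {v} w := by
    intro w d s hs hg u hu
    have := (occurs_plug (w := s) (v := u) (a := ())).1
      (by rw [Set.mem_singleton_iff.1 hu]; exact hv)
    exact hg this.1
  exact (plug_unique (O := {v}) (by rintro o rfl o' rfl d -; rfl) hw hw' (hav w) (hav w')
    rfl rfl h).1

/-- Levi's lemma for templates: the longer one of two left factors of the same template is a
multiple of the shorter one. -/
theorem plug_levi {s t a b : Ω.Term Unit} (hs : Occurs () s) (ht : Occurs () t)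
    (ha : Occurs () a) (hb : Occurs () b) (hab : size b ≤ size a) (h : plug s a = plug t b) :
    ∃ e, Occurs () e ∧ a = plug e b ∧ t = plug s e := by
  induction s generalizing t with
  | var => exact ⟨t, ht, h, rfl⟩
  | func f ss ih =>
    cases t with
    | var =>
      have := size_lt_plug hs (by simp) a
      rw [h, plug_var] at this
      omega
    | func g ts =>
      simp only [plug_func, FirstOrder.Language.Term.func.injEq] at h
      obtain ⟨rfl, h⟩ := h
      simp only [heq_eq_eq] at h
      obtain ⟨rfl, h⟩ := h
      have hiff : ∀ i, Occurs () (ss i) ↔ Occurs () (ts i) := by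
        intro i
        have h1 := occurs_plug (w := ss i) (v := a) (a := ())
        have h2 := occurs_plug (w := ts i) (v := b) (a := ())
        rw [congrFun h i] at h1
        tauto
      obtain ⟨i, hi⟩ := id hs
      obtain ⟨e, he, h1, h2⟩ := ih i hi ((hiff i).1 hi) (congrFun h i)
      refine ⟨e, he, h1, ?_⟩
      rw [plug_func]
      congr 1
      funext j
      by_cases hj : Occurs () (ss j)
      · obtain ⟨e', he', h1', h2'⟩ := ih j hj ((hiff j).1 hj) (congrFun h j)
        rw [plug_right_cancel he he' hb (h1.symm.trans h1')]
        exact h2'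
      · have e1 := congrFun h j
        have hj' := fun hc => hj ((hiff j).2 hc)
        rw [plug_congr_of_ground hj e a, e1, plug_congr_of_ground hj' b (var ()), plug_hole]

variable (Ω) in
/-- Templates: terms in which the hole occurs (arbitrarily many times). They form a monoid under
composition. -/
def Template : Type := {w : Ω.Term Unit // Occurs () w}

namespace Template

instance : Monoid (Template Ω) where
  mul w w' := ⟨plug w.1 w'.1, occurs_plug.2 ⟨w.2, w'.2⟩⟩
  one := ⟨var (), rfl⟩
  mul_assoc w w' w'' := Subtype.ext (plug_plug _ _ _)
  one_mul w := rfl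
  mul_one w := Subtype.ext (subst_var _)

@[simp] lemma val_mul (w w' : Template Ω) : (w * w').1 = plug w.1 w'.1 := rfl

lemma plug_mul (w w' : Template Ω) (v : Ω.Term α) :
    plug (w * w').1 v = plug w.1 (plug w'.1 v) := plug_plug _ _ _

lemma size_right_lt {w w' : Template Ω} (h : w ≠ 1) : size w'.1 < size (w * w').1 :=
  size_lt_plug w.2 (fun e => h (Subtype.ext e)) _

lemma eq_one_of_mul_eq_one {w w' : Template Ω} (h : w * w' = 1) : w = 1 := by
  by_contra hw
  have h1 := size_right_lt (w' := w') hw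
  rw [h] at h1
  have h2 := size_pos w'.1
  have h3 : size (1 : Template Ω).1 = 1 := rfl
  omega

lemma isUnit_iff {w : Template Ω} : IsUnit w ↔ w = 1 :=
  ⟨fun ⟨u, hu⟩ => hu ▸ eq_one_of_mul_eq_one u.mul_inv, fun h => h ▸ isUnit_one⟩

lemma size_left_lt {w w' : Template Ω} (h : w' ≠ 1) : size w.1 < size (w * w').1 := by
  have h' : 1 < size w'.1 := by
    have := size_lt_plug w'.2 (fun e => h (Subtype.ext e)) (var () : Ω.Term Unit)
    rwa [plug_hole] at this
  rw [val_mul]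
  obtain ⟨w, hw⟩ := w
  simp only
  induction w with
  | var => exact h'
  | func f ts ih =>
    rw [plug_func, size_func, size_func, add_lt_add_iff_right]
    obtain ⟨i, hi⟩ := hw
    refine Finset.sum_lt_sum (fun j _ => ?_) ⟨i, Finset.mem_univ i, ih i hi⟩
    by_cases hj : Occurs () (ts j)
    · exact (ih j hj).le
    · rw [plug_congr_of_ground hj w'.1 (var ()), plug_hole]

lemma exists_factorization (w : Template Ω) :
    ∃ l : List (Template Ω), (∀ p ∈ l, Irreducible p) ∧ l.prod = w := by
  induction h : size w.1 using Nat.strong_induction_on generalizing w with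
  | _ k ih =>
    subst h
    by_cases h1 : w = 1
    · exact ⟨[], by simp, by simp [h1]⟩
    by_cases hw : Irreducible w
    · exact ⟨[w], by simpa using hw, by simp⟩
    · rw [irreducible_iff, isUnit_iff] at hw
      push Not at hw
      obtain ⟨a, b, hab, ha, hb⟩ := hw h1
      rw [isUnit_iff] at ha hb
      obtain ⟨l, hl, rfl⟩ := ih _ (hab ▸ size_left_lt hb) a rfl
      obtain ⟨l', hl', rfl⟩ := ih _ (hab ▸ size_right_lt ha) b rfl
      exact ⟨l ++ l', by simpa [or_imp, forall_and] using ⟨hl, hl'⟩, by simp [hab]⟩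

lemma levi {s t a b : Template Ω} (hab : size b.1 ≤ size a.1) (h : s * a = t * b) :
    ∃ e, a = e * b ∧ t = s * e := by
  obtain ⟨e, he, h1, h2⟩ := plug_levi s.2 t.2 a.2 b.2 hab (congrArg Subtype.val h)
  exact ⟨⟨e, he⟩, Subtype.ext h1, Subtype.ext h2⟩

lemma cancel_irreducible {p q a b : Template Ω} (hp : Irreducible p) (hq : Irreducible q)
    (h : p * a = q * b) : p = q ∧ a = b := by
  have key : ∀ {p q a b : Template Ω}, Irreducible p → Irreducible q → p * a = q * b →
      size b.1 ≤ size a.1 → p = q ∧ a = b := by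
    intro p q a b hp hq h hab
    obtain ⟨e, rfl, rfl⟩ := levi hab h
    have := (hq.isUnit_or_isUnit rfl).resolve_left hp.not_isUnit
    rw [isUnit_iff] at this
    simp [this]
  rcases le_total (size b.1) (size a.1) with hab | hab
  · exact key hp hq h hab
  · exact (key hq hp h.symm hab).imp Eq.symm Eq.symm

lemma factorization_unique {l l' : List (Template Ω)} (hl : ∀ p ∈ l, Irreducible p)
    (hl' : ∀ p ∈ l', Irreducible p) (h : l.prod = l'.prod) : l = l' := by
  induction l generalizing l' with
  | nil =>
    cases l' with
    | nil => rfl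
    | cons q l' =>
      rw [List.prod_cons, List.prod_nil] at h
      exact absurd (isUnit_iff.2 (eq_one_of_mul_eq_one h.symm)) (hl' q (by simp)).not_isUnit
  | cons p l ih =>
    cases l' with
    | nil =>
      rw [List.prod_cons, List.prod_nil] at h
      exact absurd (isUnit_iff.2 (eq_one_of_mul_eq_one h)) (hl p (by simp)).not_isUnit
    | cons q l' =>
      rw [List.prod_cons, List.prod_cons] at h
      obtain ⟨rfl, h1⟩ := cancel_irreducible (hl p (by simp)) (hl' q (by simp)) h
      rw [ih (fun r hr => hl r (by simp [hr])) (fun r hr => hl' r (by simp [hr])) h1]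

/-- The factorization of a template into irreducible templates. -/
noncomputable def factors (w : Template Ω) : List (Template Ω) := (exists_factorization w).choose

lemma irreducible_of_mem_factors {w p : Template Ω} (h : p ∈ factors w) : Irreducible p :=
  (exists_factorization w).choose_spec.1 p h

lemma prod_factors (w : Template Ω) : (factors w).prod = w := (exists_factorization w).choose_spec.2

/-- The monoid of templates is free. -/
lemma factors_mul (w w' : Template Ω) : factors (w * w') = factors w ++ factors w' := by
  refine factorization_unique (fun p => irreducible_of_mem_factors) (fun p hp => ?_) ?_
  · rcases List.mem_append.1 hp with h | h <;> exact irreducible_of_mem_factors h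
  · rw [List.prod_append, prod_factors, prod_factors, prod_factors]

end Template

end Herbrand

namespace Herbrand
open FirstOrder.Language.Term (var func)

variable {Ω : FirstOrder.Language.{0, 0}} {α β γ : Type}

/-! ### Values built from an antichain, and their encoding by numbers -/

lemma Avoids.plug {O : Set (Ω.Term α)} {m m' : Ω.Term Unit} (h : Avoids O m) (h' : Avoids O m')
    (hm' : Occurs () m') : Avoids O (plug m m') := by
  induction m with
  | var => exact h'
  | func f ts ih =>
    intro d s hs hg v
    rw [plug_func] at hs
    cases hs with
    | refl =>
      by_cases hm : Occurs () (func f ts)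
      · exact absurd (occurs_plug.2 ⟨hm, hm'⟩) hg
      · rw [← plug_func, plug_congr_of_ground hm m' (var ()), plug_hole]
        exact h 0 _ (.refl _) hm v
    | func _ _ i hs => exact ih i (h.arg i) _ s hs hg v

/-- `v` is the result of composing templates from `ms`, applied to an element of `O`. -/
def Built (ms : Set (Template Ω)) (O : Set (Ω.Term α)) (v : Ω.Term α) : Prop :=
  ∃ ws : List (Template Ω), (∀ w ∈ ws, w ∈ ms ∧ w ≠ 1) ∧ ∃ o ∈ O, v = plug ws.prod.1 o

lemma built_of_mem {ms : Set (Template Ω)} {O : Set (Ω.Term α)} {o : Ω.Term α} (h : o ∈ O) :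
    Built ms O o := ⟨[], by simp, o, h, rfl⟩

lemma Built.plug {ms : Set (Template Ω)} {O : Set (Ω.Term α)} {v : Ω.Term α} (h : Built ms O v)
    {w : Template Ω} (hw : w ∈ ms) : Built ms O (plug w.1 v) := by
  by_cases h1 : w = 1
  · subst h1; exact h
  · obtain ⟨ws, hws, o, ho, rfl⟩ := h
    exact ⟨w :: ws, by simpa using ⟨⟨hw, h1⟩, hws⟩, o, ho, by
      rw [List.prod_cons, Template.plug_mul]⟩

lemma avoids_prod {ms : Set (Template Ω)} {O : Set (Ω.Term α)} (hms : ∀ w ∈ ms, Avoids O w.1)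
    {ws : List (Template Ω)} (hws : ∀ w ∈ ws, w ∈ ms) : Avoids O ws.prod.1 := by
  induction ws with
  | nil => exact avoids_var
  | cons w ws ih =>
    rw [List.prod_cons]
    exact (hms w (hws w (by simp))).plug (ih fun w' hw' => hws w' (by simp [hw'])) ws.prod.2

lemma factors_prod_subset {ms ws : List (Template Ω)} (hws : ∀ w ∈ ws, w ∈ ms) :
    ∀ p ∈ Template.factors ws.prod, p ∈ ms.flatMap Template.factors := by
  induction ws with
  | nil =>
    have : Template.factors (1 : Template Ω) = [] := by
      simpa using Template.factors_mul (1 : Template Ω) 1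
    simp [this]
  | cons w ws ih =>
    intro p hp
    rw [List.prod_cons, Template.factors_mul, List.mem_append] at hp
    rcases hp with hp | hp
    · exact List.mem_flatMap.2 ⟨w, hws w (by simp), hp⟩
    · exact ih (fun w' hw' => hws w' (by simp [hw'])) p hp

/-- The values built from a finite antichain by finitely many templates embed into the numbers in
such a way that the templates act as affine maps: a value is written in base `K`, its digits being
the irreducible factors of its template. -/
theorem exists_affine_code (ms : List (Template Ω)) (Ol : List (Ω.Term α))
    (hO : SubtermAntichain {o | o ∈ Ol}) (hms : ∀ w ∈ ms, Avoids {o | o ∈ Ol} w.1) :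
    ∃ (N : Ω.Term α → ℕ) (off slope : Template Ω → ℕ),
      (∀ w ∈ ms, ∀ v, Built {w | w ∈ ms} {o | o ∈ Ol} v →
        N (plug w.1 v) = off w + slope w * N v) ∧
      ∀ v v', Built {w | w ∈ ms} {o | o ∈ Ol} v → Built {w | w ∈ ms} {o | o ∈ Ol} v' →
        N v = N v' → v = v' := by
  classical
  set O : Set (Ω.Term α) := {o | o ∈ Ol} with hOdef
  set P := ms.flatMap Template.factors with hP
  let ι : Template Ω → ℕ := fun p => P.idxOf p + 1
  let κ : Ω.Term α → ℕ := fun o => Ol.idxOf o + 1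
  let K := P.length + Ol.length + 2
  let word : Template Ω → Ω.Term α → List ℕ := fun w o => (Template.factors w).map ι ++ [κ o]
  let S : Ω.Term α → Template Ω × Ω.Term α → Prop :=
    fun v x => Avoids O x.1.1 ∧ x.2 ∈ O ∧ v = plug x.1.1 x.2
  let N : Ω.Term α → ℕ := fun v =>
    if h : ∃ x, S v x then Nat.ofDigits K (word h.choose.1 h.choose.2) else 0
  have hN : ∀ w o, Avoids O w.1 → o ∈ O → N (plug w.1 o) = Nat.ofDigits K (word w o) := by
    intro w o hw ho
    have h : ∃ x, S (plug w.1 o) x := ⟨(w, o), hw, ho, rfl⟩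
    obtain ⟨h1, h2, h3⟩ := h.choose_spec
    obtain ⟨e1, e2⟩ := plug_unique hO w.2 h.choose.1.2 hw h1 ho h2 h3
    simp only [N, dif_pos h]
    rw [← Subtype.ext e1, ← e2]
  have hmem : ∀ w ∈ ms, w ∈ {w | w ∈ ms} := fun w hw => hw
  have hav : ∀ ws : List (Template Ω), (∀ w ∈ ws, w ∈ {w | w ∈ ms} ∧ w ≠ 1) → Avoids O ws.prod.1 :=
    fun ws hws => avoids_prod (ms := {w | w ∈ ms}) hms fun w hw => (hws w hw).1
  refine ⟨N, fun w => Nat.ofDigits K ((Template.factors w).map ι),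
    fun w => K ^ (Template.factors w).length, ?_, ?_⟩
  · rintro w hw v ⟨ws, hws, o, ho, rfl⟩
    rw [← Template.plug_mul, hN _ o ((hms w hw).plug (hav ws hws) ws.prod.2) ho,
      hN _ o (hav ws hws) ho]
    simp only [word, Template.factors_mul, List.map_append, List.append_assoc,
      Nat.ofDigits_append (l1 := (Template.factors w).map ι), List.length_map]
  · rintro v v' ⟨ws, hws, o, ho, rfl⟩ ⟨ws', hws', o', ho', rfl⟩ h
    rw [hN _ o (hav ws hws) ho, hN _ o' (hav ws' hws') ho'] at h
    have hdig : ∀ ws : List (Template Ω), (∀ w ∈ ws, w ∈ {w | w ∈ ms} ∧ w ≠ 1) → ∀ o ∈ O,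
        Nat.digits K (Nat.ofDigits K (word ws.prod o)) = word ws.prod o := by
      intro ws hws o ho
      refine Nat.digits_ofDigits K (by omega) _ (fun l hl => ?_) (fun _ => by simp [word, κ])
      rcases List.mem_append.1 hl with hl | hl
      · obtain ⟨p, hp, rfl⟩ := List.mem_map.1 hl
        have : P.idxOf p < P.length := List.idxOf_lt_length_iff.2
          (factors_prod_subset (fun w hw => (hws w hw).1) p hp)
        simp only [ι, K]
        omega
      · obtain rfl := List.mem_singleton.1 hl
        have := List.idxOf_lt_length_iff.2 (show o ∈ Ol from ho)
        simp only [κ, K]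
        omega
    have h := congrArg (Nat.digits K) h
    rw [hdig ws hws o ho, hdig ws' hws' o' ho'] at h
    obtain ⟨h1, h2⟩ := List.append_inj' h rfl
    have e2 : o = o' := by
      simp only [κ, List.cons.injEq, add_left_inj, and_true] at h2
      exact (List.idxOf_inj (show o ∈ Ol from ho)).1 h2
    have hdec : ∀ ws : List (Template Ω), (∀ w ∈ ws, w ∈ {w | w ∈ ms} ∧ w ≠ 1) →
        ((Template.factors ws.prod).map ι).map (fun k => P[k - 1]?) =
          (Template.factors ws.prod).map some := by
      intro ws hws
      rw [List.map_map]
      refine List.map_congr_left fun p hp => ?_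
      have hp := factors_prod_subset (fun w hw => (hws w hw).1) p hp
      simp only [Function.comp_apply, ι, Nat.add_sub_cancel]
      rw [List.getElem?_eq_getElem (List.idxOf_lt_length_iff.2 hp), List.getElem_idxOf]
    have h1 := congrArg (List.map fun k => P[k - 1]?) h1
    rw [hdec ws hws, hdec ws' hws'] at h1
    have h1 := congrArg List.prod ((Option.some_injective _).list_map h1)
    rw [Template.prod_factors, Template.prod_factors] at h1
    rw [h1, e2]

lemma exists_subAt_of_subAt_plug {O : Set (Ω.Term α)} (hO : SubtermAntichain O) {m : Ω.Term Unit}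
    (hm : Avoids O m) {r : Ω.Term α} (hr : r ∈ O) {v : Ω.Term α} {o : Ω.Term α} (ho : o ∈ O)
    {e : ℕ} (hv : SubAt e o v) {d : ℕ} (h : SubAt d r (plug m v)) :
    ∃ d', SubAt d' r v ∧ d' ≤ d ∧ (m ≠ var () → d' < d) := by
  induction m generalizing d with
  | var => exact ⟨d, h, le_rfl, fun hc => absurd rfl hc⟩
  | func f ts ih =>
    rw [plug_func] at h
    cases h with
    | refl =>
      rw [← plug_func] at hr
      by_cases hg : Occurs () (func f ts)
      · obtain ⟨d', hd'⟩ := exists_subAt_plug hg v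
        have h1 := hO _ ho _ hr _ (hv.trans hd')
        have h2 := size_lt_plug hg (by simp) v
        have h3 := hv.add_size_le
        rw [← h1] at h2
        omega
      · exact absurd hr (hm 0 _ (.refl _) hg v)
    | func _ _ i h =>
      obtain ⟨d', h1, h2, -⟩ := ih i (hm.arg i) h
      exact ⟨d', h1, by omega, fun _ => by omega⟩

/-- In a value built from `o` with `ws`, an element of the antichain occurs only as `o`, and
at a depth that bounds the number of letters of `ws`. -/
lemma length_le_of_subAt {O : Set (Ω.Term α)} (hO : SubtermAntichain O) {ws : List (Template Ω)}
    (hws : ∀ w ∈ ws, Avoids O w.1 ∧ w ≠ 1) {r o : Ω.Term α} (hr : r ∈ O) (ho : o ∈ O) {d : ℕ}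
    (h : SubAt d r (plug ws.prod.1 o)) : ws.length ≤ d ∧ r = o := by
  induction ws generalizing d with
  | nil => exact ⟨Nat.zero_le _, hO _ hr _ ho d h⟩
  | cons w ws ih =>
    rw [List.prod_cons, Template.plug_mul] at h
    obtain ⟨e, he⟩ := exists_subAt_plug ws.prod.2 o
    obtain ⟨hw1, hw2⟩ := hws w (by simp)
    obtain ⟨d', h1, -, h2⟩ := exists_subAt_of_subAt_plug hO hw1 hr ho he h
    obtain ⟨h3, h4⟩ := ih (fun w' hw' => hws w' (by simp [hw'])) h1
    have := h2 fun e => hw2 (Subtype.ext e)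
    simp only [List.length_cons]
    exact ⟨by omega, h4⟩

/-- The list of all values obtained from `r` by at most `k` templates from `ms`. -/
def valuesUpTo (ms : List (Template Ω)) (r : Ω.Term α) : ℕ → List (Ω.Term α)
  | 0 => [r]
  | k + 1 => valuesUpTo ms r k ++ ms.flatMap fun w => (valuesUpTo ms r k).map (plug w.1)

lemma length_valuesUpTo (ms : List (Template Ω)) (r : Ω.Term α) (k : ℕ) :
    (valuesUpTo ms r k).length = (ms.length + 1) ^ k := by
  induction k with
  | zero => rfl
  | succ k ih =>
    simp [valuesUpTo, List.length_flatMap, ih]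
    ring

lemma mem_valuesUpTo {ms : List (Template Ω)} {r : Ω.Term α} {k : ℕ} {ws : List (Template Ω)}
    (hws : ∀ w ∈ ws, w ∈ ms) (hk : ws.length ≤ k) : plug ws.prod.1 r ∈ valuesUpTo ms r k := by
  induction k generalizing ws with
  | zero =>
    obtain rfl := List.length_eq_zero_iff.1 (Nat.le_zero.1 hk)
    exact List.mem_singleton.2 rfl
  | succ k ih =>
    rw [valuesUpTo, List.mem_append]
    cases ws with
    | nil => exact .inl (ih hws (Nat.zero_le _))
    | cons w ws =>
      refine .inr (List.mem_flatMap.2 ⟨w, hws w (by simp), List.mem_map.2 ⟨_, ih (ws := ws)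
        (fun w' hw' => hws w' (by simp [hw'])) (by simpa using hk), ?_⟩⟩)
      rw [List.prod_cons, Template.plug_mul]

end Herbrand

namespace Herbrand

/-! ### Runs of bounded derivation height -/

/-- Edges of a system of straight-line runs. The label of an edge is either a list of assignments
`(x, t)`, or a pair `(a, b)` of points, which stands for an arbitrary run from `a` to `b`. -/
abbrev Edge (T : Type) : Type := ℕ × (List (ℕ × T) ⊕ (ℕ × ℕ)) × ℕ

/-- A run `(u, l, v)` leads from `u` to `v` and executes the assignments of `l` in turn. -/
abbrev Run (T : Type) : Type := ℕ × List (ℕ × T) × ℕ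

section Levels

variable {T : Type}

/-- Extend the given runs by one edge; the summaries are taken from the given runs as well. -/
def levelStep (es : List (Edge T)) (S : List (Run T)) : List (Run T) :=
  S ++ es.flatMap fun e => S.flatMap fun a =>
    if a.2.2 = e.1 then
      Sum.elim (fun ops => [(a.1, a.2.1 ++ ops, e.2.2)])
        (fun c => S.flatMap fun b =>
          if b.1 = c.1 ∧ b.2.2 = c.2 then [(a.1, a.2.1 ++ b.2.1, e.2.2)] else []) e.2.1
    else []

/-- The runs with a derivation of height at most `k`, in a system with points below `P`. -/
def level (P : ℕ) (es : List (Edge T)) : ℕ → List (Run T)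
  | 0 => (List.range P).map fun u => (u, [], u)
  | k + 1 => levelStep es (level P es k)

lemma mem_level_zero {P : ℕ} {es : List (Edge T)} {u v : ℕ} {l : List (ℕ × T)} :
    (u, l, v) ∈ level P es 0 ↔ u < P ∧ l = [] ∧ u = v := by
  simp only [level, List.mem_map, List.mem_range, Prod.mk.injEq]
  exact ⟨fun ⟨a, h, h1, h2, h3⟩ => ⟨h1 ▸ h, h2.symm, h1.symm.trans h3⟩,
    fun ⟨h1, h2, h3⟩ => ⟨u, h1, rfl, h2.symm, h3⟩⟩

lemma mem_level_succ {P : ℕ} {es : List (Edge T)} {k u w : ℕ} {l : List (ℕ × T)} :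
    (u, l, w) ∈ level P es (k + 1) ↔ (u, l, w) ∈ level P es k ∨
      (∃ l₁ v ops, (u, l₁, v) ∈ level P es k ∧ (v, Sum.inl ops, w) ∈ es ∧ l = l₁ ++ ops) ∨
      ∃ l₁ v a b l₂, (u, l₁, v) ∈ level P es k ∧ (v, Sum.inr (a, b), w) ∈ es ∧
        (a, l₂, b) ∈ level P es k ∧ l = l₁ ++ l₂ := by
  rw [level, levelStep, List.mem_append]
  refine or_congr_right ?_
  constructor
  · intro h
    obtain ⟨⟨v, st, w'⟩, he, h'⟩ := List.mem_flatMap.1 h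
    clear h
    obtain ⟨⟨u', l₁, v'⟩, ha, h⟩ := List.mem_flatMap.1 h'
    clear h'
    simp only at h
    split_ifs at h with hv
    · subst hv
      rcases st with ops | ⟨a, b⟩
      · simp only [Sum.elim_inl, List.mem_singleton, Prod.mk.injEq] at h
        obtain ⟨rfl, rfl, rfl⟩ := h
        exact .inl ⟨_, _, _, ha, he, rfl⟩
      · simp only [Sum.elim_inr] at h
        obtain ⟨⟨a', l₂, b'⟩, hb, h'⟩ := List.mem_flatMap.1 h
        simp only at h'
        split_ifs at h' with hc
        · obtain ⟨rfl, rfl⟩ := hc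
          simp only [List.mem_singleton, Prod.mk.injEq] at h'
          obtain ⟨rfl, rfl, rfl⟩ := h'
          exact .inr ⟨_, _, _, _, _, ha, he, hb, rfl⟩
        · simp at h'
    · simp at h
  · rintro (⟨l₁, v, ops, ha, he, rfl⟩ | ⟨l₁, v, a, b, l₂, ha, he, hb, rfl⟩)
    · exact List.mem_flatMap.2 ⟨_, he, List.mem_flatMap.2 ⟨_, ha, by simp⟩⟩
    · refine List.mem_flatMap.2 ⟨_, he, List.mem_flatMap.2 ⟨_, ha, ?_⟩⟩
      simp only [if_true, Sum.elim_inr]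
      exact List.mem_flatMap.2 ⟨_, hb, by simp⟩

lemma level_mono {P : ℕ} {es : List (Edge T)} {j k : ℕ} (h : j ≤ k) {x : Run T}
    (hx : x ∈ level P es j) : x ∈ level P es k := by
  induction k, h using Nat.le_induction with
  | base => exact hx
  | succ k _ ih => exact mem_level_succ.2 (.inl ih)

lemma level_induction {P : ℕ} {es : List (Edge T)} {C : ℕ → List (ℕ × T) → ℕ → Prop}
    (h0 : ∀ u, u < P → C u [] u)
    (h1 : ∀ u l v ops w, C u l v → (v, Sum.inl ops, w) ∈ es → C u (l ++ ops) w)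
    (h2 : ∀ u l v a b l' w, C u l v → (v, Sum.inr (a, b), w) ∈ es → C a l' b → C u (l ++ l') w)
    {k u v : ℕ} {l : List (ℕ × T)} (h : (u, l, v) ∈ level P es k) : C u l v := by
  induction k generalizing u v l with
  | zero =>
    obtain ⟨hu, rfl, rfl⟩ := mem_level_zero.1 h
    exact h0 u hu
  | succ k ih =>
    rcases mem_level_succ.1 h with h | ⟨l₁, v, ops, ha, he, rfl⟩ |
      ⟨l₁, v, a, b, l₂, ha, he, hb, rfl⟩
    · exact ih h
    · exact h1 _ _ _ _ _ (ih ha) he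
    · exact h2 _ _ _ _ _ _ _ (ih ha) he (ih hb)

lemma level_lt {P : ℕ} {es : List (Edge T)} (hes : ∀ e ∈ es, e.2.2 < P) {k u v : ℕ}
    {l : List (ℕ × T)} (h : (u, l, v) ∈ level P es k) : u < P ∧ v < P :=
  level_induction (C := fun u _ v => u < P ∧ v < P) (fun _ h => ⟨h, h⟩)
    (fun _ _ _ _ _ h he => ⟨h.1, hes _ he⟩) (fun _ _ _ _ _ _ _ h he _ => ⟨h.1, hes _ he⟩) h

end Levels

/-! ### Linear representations of runs -/

/-- An ascending chain of families of subspaces that is constant from its first repetition on has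
reached its limit after as many steps as the dimension allows. -/
lemma chain_stabilizes {ι W : Type} [Fintype ι] [AddCommGroup W] [Module ℚ W]
    [Module.Finite ℚ W] (V : ℕ → ι → Submodule ℚ W) (hmono : Monotone V)
    (hstab : ∀ k, V k = V (k + 1) → V (k + 1) = V (k + 2)) (k : ℕ) :
    V k ≤ V (Fintype.card ι * Module.finrank ℚ W) := by
  classical
  set d := Fintype.card ι * Module.finrank ℚ W with hd
  let p : ℕ → Submodule ℚ (ι → W) := fun k => Submodule.pi Set.univ (V k)
  have hle : ∀ {j k}, p j ≤ p k → V j ≤ V k := by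
    intro j k h i x hx
    have : Pi.single i x ∈ p j := by
      intro i' _
      by_cases h : i' = i
      · subst h; simpa using hx
      · simp [h]
    simpa using h this i trivial
  have hpm : Monotone p := fun j k h => Submodule.pi_mono fun i _ => hmono h i
  have hex : ∃ k ≤ d, V k = V (k + 1) := by
    by_contra! hne
    have hrank : ∀ k ≤ d + 1, k ≤ Module.finrank ℚ (p k) := by
      intro k hk
      induction k with
      | zero => exact Nat.zero_le _
      | succ k ih =>
        have h1 := ih (by omega)
        have h2 : p k < p (k + 1) := (hpm (Nat.le_succ k)).lt_of_not_ge fun h =>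
          hne k (by omega) (le_antisymm (hmono (Nat.le_succ k)) (hle h))
        have := Submodule.finrank_lt_finrank_of_lt h2
        omega
    have h1 := hrank (d + 1) le_rfl
    have h2 := Submodule.finrank_le (p (d + 1))
    rw [Module.finrank_pi_fintype, Finset.sum_const, Finset.card_univ, smul_eq_mul] at h2
    omega
  obtain ⟨k₀, hk₀, h⟩ := hex
  have hconst : ∀ j, V (k₀ + j) = V k₀ ∧ V (k₀ + j) = V (k₀ + j + 1) := by
    intro j
    induction j with
    | zero => exact ⟨rfl, h⟩
    | succ j ih => exact ⟨ih.2.symm.trans ih.1, hstab _ ih.2⟩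
  rcases le_total k d with hkd | hkd
  · exact hmono hkd
  · obtain ⟨j, rfl⟩ := Nat.exists_eq_add_of_le (hk₀.trans hkd)
    rw [(hconst j).1]
    exact hmono hk₀

/-- A linear functional that vanishes on the matrices of all runs of a certain height vanishes on
the matrices of all runs. -/
theorem exists_short_of_linear {T I : Type} [Fintype I] [DecidableEq I] {P : ℕ}
    {es : List (Edge T)} (hes : ∀ e ∈ es, e.2.2 < P)
    (F : List (ℕ × T) → Matrix I I ℚ) (hF : ∀ l l', F (l ++ l') = F l * F l')
    (φ : Matrix I I ℚ →ₗ[ℚ] ℚ) {k u v : ℕ} {l : List (ℕ × T)} (h : (u, l, v) ∈ level P es k)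
    (hφ : φ (F l) ≠ 0) :
    ∃ l', (u, l', v) ∈ level P es (P ^ 2 * Fintype.card I ^ 2) ∧ φ (F l') ≠ 0 := by
  let G : ℕ → ℕ → ℕ → Set (Matrix I I ℚ) :=
    fun k u v => {X | ∃ l, (u, l, v) ∈ level P es k ∧ X = F l}
  let V : ℕ → Fin P × Fin P → Submodule ℚ (Matrix I I ℚ) :=
    fun k x => Submodule.span ℚ (G k x.1 x.2)
  have hV : ∀ {k u v l} (h : (u, l, v) ∈ level P es k),
      F l ∈ V k (⟨u, (level_lt hes h).1⟩, ⟨v, (level_lt hes h).2⟩) :=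
    fun h => Submodule.subset_span ⟨_, h, rfl⟩
  have hstab : ∀ k, V k = V (k + 1) → V (k + 1) = V (k + 2) := by
    intro k hk
    funext x
    refine le_antisymm (Submodule.span_mono fun X ⟨l, h, e⟩ => ⟨l, mem_level_succ.2 (.inl h), e⟩) ?_
    refine Submodule.span_le.2 ?_
    rintro _ ⟨l, h, rfl⟩
    rcases mem_level_succ.1 h with h | ⟨l₁, v, ops, ha, he, rfl⟩ |
      ⟨l₁, v, a, b, l₂, ha, he, hb, rfl⟩
    · exact hV h
    · have h1 := hV ha
      rw [← hk] at h1
      rw [hF, SetLike.mem_coe]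
      refine Submodule.span_induction (p := fun X _ => X * F ops ∈ V (k + 1) x) ?_ ?_ ?_ ?_ h1
      · rintro _ ⟨l, hl, rfl⟩
        rw [← hF]
        exact hV (mem_level_succ.2 (.inr (.inl ⟨_, _, _, hl, he, rfl⟩)))
      · simp
      · intro X Y _ _ hX hY
        rw [add_mul]; exact add_mem hX hY
      · intro c X _ hX
        rw [smul_mul_assoc]; exact Submodule.smul_mem _ _ hX
    · have h1 := hV ha
      have h2 := hV hb
      rw [← hk] at h1 h2
      rw [hF, SetLike.mem_coe]
      refine Submodule.span_induction (p := fun X _ => X * F l₂ ∈ V (k + 1) x) ?_ ?_ ?_ ?_ h1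
      · rintro _ ⟨l, hl, rfl⟩
        refine Submodule.span_induction (p := fun Y _ => F l * Y ∈ V (k + 1) x) ?_ ?_ ?_ ?_ h2
        · rintro _ ⟨l', hl', rfl⟩
          rw [← hF]
          exact hV (mem_level_succ.2 (.inr (.inr ⟨_, _, _, _, _, hl, he, hl', rfl⟩)))
        · simp
        · intro X Y _ _ hX hY
          rw [mul_add]; exact add_mem hX hY
        · intro c X _ hX
          rw [mul_smul_comm]; exact Submodule.smul_mem _ _ hX
      · simp
      · intro X Y _ _ hX hY
        rw [add_mul]; exact add_mem hX hY
      · intro c X _ hX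
        rw [smul_mul_assoc]; exact Submodule.smul_mem _ _ hX
  have hmono : Monotone V := monotone_nat_of_le_succ fun k x =>
    Submodule.span_mono fun X ⟨l, h, e⟩ => ⟨l, mem_level_succ.2 (.inl h), e⟩
  have hlim := chain_stabilizes V hmono hstab k
  have hcard : Fintype.card (Fin P × Fin P) * Module.finrank ℚ (Matrix I I ℚ) =
      P ^ 2 * Fintype.card I ^ 2 := by
    simp [Module.finrank_matrix, sq]
  rw [hcard] at hlim
  by_contra! hc
  have hker : V (P ^ 2 * Fintype.card I ^ 2)
      (⟨u, (level_lt hes h).1⟩, ⟨v, (level_lt hes h).2⟩) ≤ LinearMap.ker φ := by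
    refine Submodule.span_le.2 ?_
    rintro _ ⟨l', hl', rfl⟩
    exact hc l' hl'
  exact hφ (hker (hlim _ (hV h)))

/-- The `J`-fold Kronecker power of a matrix. -/
def kroneckerPow {A : Type} (J : ℕ) (X : Matrix A A ℚ) : Matrix (Fin J → A) (Fin J → A) ℚ :=
  Matrix.of fun k l => ∏ j, X (k j) (l j)

lemma kroneckerPow_mul {A : Type} [Fintype A] [DecidableEq A] (J : ℕ) (X Y : Matrix A A ℚ) :
    kroneckerPow J (X * Y) = kroneckerPow J X * kroneckerPow J Y := by
  ext k l
  simp only [kroneckerPow, Matrix.of_apply, Matrix.mul_apply, Finset.prod_univ_sum,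
    Fintype.piFinset_univ, Finset.prod_mul_distrib]

/-- If a product of linear forms does not vanish on the vector of some run, then it does not vanish
on the vector of some run of bounded height. -/
theorem exists_short_of_prod_ne_zero {T A : Type} [Fintype A] [DecidableEq A] {P J : ℕ}
    {es : List (Edge T)} (hes : ∀ e ∈ es, e.2.2 < P) (M : ℕ × T → Matrix A A ℚ) (z₀ : A → ℚ)
    (f : Fin J → A → ℚ) {k u v : ℕ} {l : List (ℕ × T)} (h : (u, l, v) ∈ level P es k)
    (hf : ∏ j, Matrix.vecMul z₀ (l.map M).prod ⬝ᵥ f j ≠ 0) :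
    ∃ l', (u, l', v) ∈ level P es (P ^ 2 * (Fintype.card A ^ J) ^ 2) ∧
      ∏ j, Matrix.vecMul z₀ (l'.map M).prod ⬝ᵥ f j ≠ 0 := by
  let φ : Matrix (Fin J → A) (Fin J → A) ℚ →ₗ[ℚ] ℚ :=
    { toFun := fun X => ∑ m, ∑ k, (∏ j, z₀ (k j)) * X k m * ∏ j, f j (m j)
      map_add' := by
        intro X Y
        simp only [Matrix.add_apply, mul_add, add_mul, Finset.sum_add_distrib]
      map_smul' := by
        intro c X
        simp only [Matrix.smul_apply, smul_eq_mul, RingHom.id_apply, Finset.mul_sum]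
        refine Finset.sum_congr rfl fun m _ => Finset.sum_congr rfl fun k _ => ?_
        ring }
  have hφ : ∀ X : Matrix A A ℚ,
      φ (kroneckerPow J X) = ∏ j, Matrix.vecMul z₀ X ⬝ᵥ f j := by
    intro X
    simp only [dotProduct, Matrix.vecMul, Finset.sum_mul, Finset.prod_univ_sum,
      Fintype.piFinset_univ, Finset.prod_mul_distrib]
    rfl
  have := exists_short_of_linear hes (fun l => kroneckerPow J (l.map M).prod)
    (fun l l' => by rw [List.map_append, List.prod_append, kroneckerPow_mul]) φ h
    (by rwa [hφ])
  simpa [hφ] using this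

end Herbrand

namespace Herbrand
open FirstOrder.Language.Term (var func)

variable {Ω : FirstOrder.Language.{0, 0}} {α β γ : Type}

/-! ### Violations of equalities by runs of bounded height -/

/-- The weakest precondition of a term with respect to the assignments of `l`: the value after `l`
as a term in the initial values of the variables. -/
def wp (l : List (ℕ × Ω.Term ℕ)) (t : Ω.Term ℕ) : Ω.Term ℕ :=
  l.foldr (fun o t => t.subst fun i => if i = o.1 then o.2 else var i) t

lemma wp_append (l l' : List (ℕ × Ω.Term ℕ)) (t : Ω.Term ℕ) :
    wp (l ++ l') t = wp l (wp l' t) := List.foldr_append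

lemma wp_eq_subst (l : List (ℕ × Ω.Term ℕ)) (t : Ω.Term ℕ) :
    wp l t = t.subst fun i => wp l (var i) := by
  induction l with
  | nil => exact (subst_var t).symm
  | cons o l ih =>
    simp only [wp, List.foldr_cons] at ih ⊢
    rw [ih, subst_subst]

lemma wp_func (l : List (ℕ × Ω.Term ℕ)) {k : ℕ} (f : Ω.Functions k) (ts : Fin k → Ω.Term ℕ) :
    wp l (func f ts) = func f fun i => wp l (ts i) := by
  rw [wp_eq_subst]
  simp only [FirstOrder.Language.Term.subst, ← wp_eq_subst]

lemma wp_plug (l : List (ℕ × Ω.Term ℕ)) (w : Ω.Term Unit) (t : Ω.Term ℕ) :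
    wp l (plug w t) = plug w (wp l t) := by
  rw [wp_eq_subst l (plug w t), wp_eq_subst l t]
  exact subst_subst _ _ _

lemma wp_eq_self {n : ℕ} {l : List (ℕ × Ω.Term ℕ)} (hl : ∀ o ∈ l, o.1 < n) {t : Ω.Term ℕ}
    (ht : ∀ i < n, ¬ Occurs i t) : wp l t = t := by
  induction l with
  | nil => rfl
  | cons o l ih =>
    have h1 := ih fun o ho => hl o (by simp [ho])
    simp only [wp, List.foldr_cons] at h1 ⊢
    rw [h1]
    nth_rw 2 [← subst_var t]
    refine subst_congr fun i hi => if_neg ?_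
    rintro rfl
    exact ht _ (hl o (by simp)) hi

/-- The assignments that an initialization-restricted program executes: the right-hand side is an
element of `Ol` in which no program variable occurs, or a template from `ms` applied to a program
variable. -/
def AdmissibleOp (n : ℕ) (ms : List (Template Ω)) (Ol : List (Ω.Term ℕ)) (o : ℕ × Ω.Term ℕ) :
    Prop :=
  o.1 < n ∧ ((o.2 ∈ Ol ∧ ∀ i < n, ¬ Occurs i o.2) ∨ ∃ y < n, ∃ w ∈ ms, o.2 = plug w.1 (var y))

/-- A system of runs with points below `P` and admissible assignments: the templates `ms` avoid the
antichain `Ol`, which contains the initial values of the variables. -/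
structure Admissible (P n : ℕ) (ms : List (Template Ω)) (Ol : List (Ω.Term ℕ))
    (es : List (Edge (Ω.Term ℕ))) : Prop where
  target_lt : ∀ e ∈ es, e.2.2 < P
  op : ∀ v ops w, (v, Sum.inl ops, w) ∈ es → ∀ o ∈ ops, AdmissibleOp n ms Ol o
  antichain : SubtermAntichain {o | o ∈ Ol}
  avoids : ∀ w ∈ ms, Avoids {o | o ∈ Ol} w.1
  var_mem : ∀ i < n, var i ∈ Ol

section

variable {P n : ℕ} {ms : List (Template Ω)} {Ol : List (Ω.Term ℕ)} {es : List (Edge (Ω.Term ℕ))}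

lemma Admissible.op_of_mem_level (H : Admissible P n ms Ol es) {k u v : ℕ}
    {l : List (ℕ × Ω.Term ℕ)} (h : (u, l, v) ∈ level P es k) :
    ∀ o ∈ l, AdmissibleOp n ms Ol o :=
  level_induction (C := fun _ l _ => ∀ o ∈ l, AdmissibleOp n ms Ol o) (by simp)
    (fun _ _ _ _ _ h he o ho => (List.mem_append.1 ho).elim (h o) (H.op _ _ _ he o))
    (fun _ _ _ _ _ _ _ h _ h' o ho => (List.mem_append.1 ho).elim (h o) (h' o)) h

lemma Admissible.built (H : Admissible P n ms Ol es) {l : List (ℕ × Ω.Term ℕ)}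
    (hl : ∀ o ∈ l, AdmissibleOp n ms Ol o) {i : ℕ} (hi : i < n) :
    Built {w | w ∈ ms} {o | o ∈ Ol} (wp l (var i)) := by
  induction l using List.reverseRecOn generalizing i with
  | nil => exact built_of_mem (H.var_mem i hi)
  | append_singleton l o ih =>
    have hl' : ∀ o ∈ l, AdmissibleOp n ms Ol o := fun o ho => hl o (by simp [ho])
    rw [wp_append, show wp [o] (var i) = if i = o.1 then o.2 else var i from rfl]
    split_ifs with h
    · obtain ⟨-, ⟨h1, h2⟩ | ⟨y, hy, w, hw, h1⟩⟩ := hl o (by simp)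
      · rw [wp_eq_self (fun o ho => (hl' o ho).1) h2]
        exact built_of_mem h1
      · rw [h1, wp_plug]
        exact (ih hl' hy).plug hw
    · exact ih hl' hi

/-- The numbers that encode the values of the variables after `l`, and the number `1`. -/
def stateVec (n : ℕ) (N : Ω.Term ℕ → ℕ) (l : List (ℕ × Ω.Term ℕ)) : Option (Fin n) → ℚ
  | none => 1
  | some i => N (wp l (var i))

/-- Admissible assignments act linearly on the numbers that encode the values. -/
lemma Admissible.exists_matrix (H : Admissible P n ms Ol es) {N : Ω.Term ℕ → ℕ}
    {off slope : Template Ω → ℕ}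
    (hN : ∀ w ∈ ms, ∀ v, Built {w | w ∈ ms} {o | o ∈ Ol} v →
      N (plug w.1 v) = off w + slope w * N v) :
    ∃ M : ℕ × Ω.Term ℕ → Matrix (Option (Fin n)) (Option (Fin n)) ℚ,
      ∀ l, (∀ o ∈ l, AdmissibleOp n ms Ol o) →
        stateVec n N l = Matrix.vecMul (stateVec n N []) (l.map M).prod := by
  have hcol : ∀ o, ∃ X : Matrix (Option (Fin n)) (Option (Fin n)) ℚ, AdmissibleOp n ms Ol o →
      ∀ l, (∀ o ∈ l, AdmissibleOp n ms Ol o) →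
        stateVec n N (l ++ [o]) = Matrix.vecMul (stateVec n N l) X := by
    intro o
    by_cases ho : AdmissibleOp n ms Ol o
    swap
    · exact ⟨0, fun h => absurd h ho⟩
    have : ∀ b, ∃ c : Option (Fin n) → ℚ, ∀ l, (∀ o ∈ l, AdmissibleOp n ms Ol o) →
        stateVec n N (l ++ [o]) b = stateVec n N l ⬝ᵥ c := by
      rintro (- | i)
      · exact ⟨Pi.single none 1, fun l _ => by simp [stateVec]⟩
      have hwp : ∀ l, wp (l ++ [o]) (var i) = wp l (if (i : ℕ) = o.1 then o.2 else var i) :=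
        fun l => wp_append l [o] _
      by_cases hi : (i : ℕ) = o.1
      · have hwp' : ∀ l, wp (l ++ [o]) (var i) = wp l o.2 :=
          fun l => (hwp l).trans (by rw [if_pos hi])
        obtain ⟨-, ⟨h1, h2⟩ | ⟨y, hy, w, hw, h1⟩⟩ := ho
        · refine ⟨Pi.single none (N o.2 : ℚ), fun l hl => ?_⟩
          simp only [stateVec, hwp', dotProduct_single, one_mul]
          rw [wp_eq_self (fun o ho => (hl o ho).1) h2]
        · refine ⟨Pi.single none (off w : ℚ) + Pi.single (some ⟨y, hy⟩) (slope w : ℚ),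
            fun l hl => ?_⟩
          simp only [stateVec, hwp', dotProduct_add, dotProduct_single, one_mul]
          rw [h1, wp_plug, hN w hw _ (H.built hl hy)]
          push_cast
          ring
      · refine ⟨Pi.single (some i) 1, fun l _ => ?_⟩
        simp only [stateVec, hwp, hi, if_false, dotProduct_single, mul_one]
    choose c hc using this
    exact ⟨Matrix.of fun a b => c b a, fun _ l hl => funext fun b => hc b l hl⟩
  choose M hM using hcol
  refine ⟨M, fun l hl => ?_⟩
  induction l using List.reverseRecOn with
  | nil => simp
  | append_singleton l o ih =>
    rw [hM o (hl o (by simp)) l fun o ho => hl o (by simp [ho]),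
      ih fun o ho => hl o (by simp [ho]), Matrix.vecMul_vecMul]
    simp

/-- A property of runs that is refuted by a product of linear forms in the numbers encoding the
values is violated by a short run if it is violated at all. -/
lemma Admissible.exists_short_of_forms (H : Admissible P n ms Ol es) {N : Ω.Term ℕ → ℕ}
    {off slope : Template Ω → ℕ}
    (hN : ∀ w ∈ ms, ∀ v, Built {w | w ∈ ms} {o | o ∈ Ol} v →
      N (plug w.1 v) = off w + slope w * N v) {J : ℕ} (f : Fin J → Option (Fin n) → ℚ)
    {C : List (ℕ × Ω.Term ℕ) → Prop}
    (hC : ∀ l, (∀ o ∈ l, AdmissibleOp n ms Ol o) → C l → ∏ j, stateVec n N l ⬝ᵥ f j = 0)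
    {k u v : ℕ} {l : List (ℕ × Ω.Term ℕ)} (h : (u, l, v) ∈ level P es k)
    (hl : ∀ j, stateVec n N l ⬝ᵥ f j ≠ 0) :
    ∃ l', (u, l', v) ∈ level P es (P ^ 2 * ((n + 1) ^ J) ^ 2) ∧ ¬ C l' := by
  obtain ⟨M, hM⟩ := H.exists_matrix hN
  obtain ⟨l', h1, h2⟩ := exists_short_of_prod_ne_zero H.target_lt M (stateVec n N []) f h
    (by rw [← hM l (H.op_of_mem_level h)]; exact Finset.prod_ne_zero_iff.2 fun j _ => hl j)
  rw [Fintype.card_option, Fintype.card_fin] at h1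
  refine ⟨l', h1, fun hc => h2 ?_⟩
  rw [← hM l' (H.op_of_mem_level h1)]
  exact hC l' (H.op_of_mem_level h1) hc

lemma built_of_mem_valuesUpTo {r : Ω.Term ℕ} (hr : r ∈ Ol) {k : ℕ} {v : Ω.Term ℕ}
    (h : v ∈ valuesUpTo ms r k) : Built {w | w ∈ ms} {o | o ∈ Ol} v := by
  induction k generalizing v with
  | zero =>
    obtain rfl := List.mem_singleton.1 h
    exact built_of_mem hr
  | succ k ih =>
    rcases List.mem_append.1 h with h | h
    · exact ih h
    · obtain ⟨w, hw, h⟩ := List.mem_flatMap.1 h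
      obtain ⟨v, hv, rfl⟩ := List.mem_map.1 h
      exact (ih hv).plug hw

/-- The case of a constant equality `x ≐ t`: it is expressed by one linear form if `t` can be the
value of a variable at all, and otherwise it is violated by each run. -/
lemma Admissible.exists_short_of_ne_ground (H : Admissible P n ms Ol es) {J : ℕ} (hJ : 0 < J)
    {x : ℕ} (hx : x < n) {t : Ω.Term ℕ} (ht : ∀ i < n, ¬ Occurs i t) {k u v : ℕ}
    {l : List (ℕ × Ω.Term ℕ)} (h : (u, l, v) ∈ level P es k) (hl : wp l (var x) ≠ wp l t) :
    ∃ l', (u, l', v) ∈ level P es (P ^ 2 * ((n + 1) ^ J) ^ 2) ∧ wp l' (var x) ≠ wp l' t := by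
  have : Nonempty (Fin J) := ⟨⟨0, hJ⟩⟩
  obtain ⟨N, off, slope, hN, hinj⟩ := exists_affine_code ms Ol H.antichain H.avoids
  have hwp : ∀ l, (∀ o ∈ l, AdmissibleOp n ms Ol o) → wp l t = t :=
    fun l hl => wp_eq_self (fun o ho => (hl o ho).1) ht
  have hadm := H.op_of_mem_level h
  by_cases hb : Built {w | w ∈ ms} {o | o ∈ Ol} t
  · refine H.exists_short_of_forms hN
      (fun _ => Pi.single (some ⟨x, hx⟩) 1 - Pi.single none (N t : ℚ))
      (C := fun l => wp l (var x) = wp l t) (fun l hl hc => ?_) h fun _ => ?_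
    · rw [hwp l hl] at hc
      simp [stateVec, hc, hJ.ne']
    · simp only [dotProduct_sub, dotProduct_single, stateVec, mul_one, one_mul, sub_ne_zero]
      rw [hwp l hadm] at hl
      exact fun e => hl (hinj _ _ (H.built hadm hx) hb (by exact_mod_cast e))
  · refine H.exists_short_of_forms hN (J := J) (fun _ => Pi.single none 1)
      (C := fun l => wp l (var x) = wp l t) (fun l hl hc => ?_) h fun _ => by simp [stateVec]
    rw [hwp l hl] at hc
    exact absurd (hc ▸ H.built hl hx) hb

/-- If the template `w` avoids the antichain, then `x ≐ w y` is expressed by one linear form. -/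
lemma Admissible.exists_short_of_ne_avoiding (H : Admissible P n ms Ol es) {J : ℕ} (hJ : 0 < J)
    {x y : ℕ} (hx : x < n) (hy : y < n) {w : Template Ω} (hw : Avoids {o | o ∈ Ol} w.1)
    {k u v : ℕ} {l : List (ℕ × Ω.Term ℕ)} (h : (u, l, v) ∈ level P es k)
    (hl : wp l (var x) ≠ wp l (plug w.1 (var y))) :
    ∃ l', (u, l', v) ∈ level P es (P ^ 2 * ((n + 1) ^ J) ^ 2) ∧
      wp l' (var x) ≠ wp l' (plug w.1 (var y)) := by
  have : Nonempty (Fin J) := ⟨⟨0, hJ⟩⟩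
  -- the template of the equality may be regarded as one of the templates of the program
  have H' : Admissible P n (w :: ms) Ol es :=
    { H with
      op := fun v ops u he o ho => (H.op v ops u he o ho).imp_right <| Or.imp_right <|
        fun ⟨y, hy, w', hw', e⟩ => ⟨y, hy, w', by simp [hw'], e⟩
      avoids := by simpa using ⟨hw, H.avoids⟩ }
  obtain ⟨N, off, slope, hN, hinj⟩ := exists_affine_code (w :: ms) Ol H'.antichain H'.avoids
  obtain ⟨c, hval⟩ : ∃ c : Option (Fin n) → ℚ, ∀ l, (∀ o ∈ l, AdmissibleOp n (w :: ms) Ol o) →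
      stateVec n N l ⬝ᵥ c = N (wp l (var x)) - N (wp l (plug w.1 (var y))) := by
    refine ⟨Pi.single (some ⟨x, hx⟩) 1 - (Pi.single none (off w : ℚ) +
      Pi.single (some ⟨y, hy⟩) (slope w : ℚ)), fun l hl => ?_⟩
    rw [wp_plug, hN w (by simp) _ (H'.built hl hy)]
    simp only [dotProduct_sub, dotProduct_add, dotProduct_single, stateVec]
    push_cast
    ring
  refine H'.exists_short_of_forms hN (fun _ => c)
    (C := fun l => wp l (var x) = wp l (plug w.1 (var y))) (fun l hl hc => ?_) h fun _ => ?_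
  · simp [hval l hl, hc, hJ.ne']
  · have hadm := H'.op_of_mem_level h
    rw [hval l hadm, sub_ne_zero]
    refine fun e => hl (hinj _ _ (H'.built hadm hx) ?_ (by exact_mod_cast e))
    rw [wp_plug]
    exact (H'.built hadm hy).plug (by simp)

/-- If an element `r` of the antichain is a subterm of the template `w`, then `x ≐ w y` only holds
for finitely many values of `x`. -/
lemma Admissible.exists_short_of_ne_not_avoiding (H : Admissible P n ms Ol es) {J : ℕ}
    {x y : ℕ} (hx : x < n) (hy : y < n) {w : Template Ω} (hw : ¬ Avoids {o | o ∈ Ol} w.1)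
    (hJ : (ms.length + 1) ^ size w.1 ≤ J) {k u v : ℕ} {l : List (ℕ × Ω.Term ℕ)}
    (h : (u, l, v) ∈ level P es k) (hl : wp l (var x) ≠ wp l (plug w.1 (var y))) :
    ∃ l', (u, l', v) ∈ level P es (P ^ 2 * ((n + 1) ^ J) ^ 2) ∧
      wp l' (var x) ≠ wp l' (plug w.1 (var y)) := by
  classical
  obtain ⟨N, off, slope, hN, hinj⟩ := exists_affine_code ms Ol H.antichain H.avoids
  simp only [Avoids, not_forall, not_not] at hw
  obtain ⟨d, s, hs, hg, v', hr⟩ := hw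
  set r := plug s v' with hrdef
  have hadm := H.op_of_mem_level h
  set X := wp l (var x) with hX
  let ξ : Fin J → Ω.Term ℕ := fun j => (valuesUpTo ms r (size w.1)).getD j r
  have hξ : ∀ j, Built {w | w ∈ ms} {o | o ∈ Ol} (ξ j) := by
    intro j
    simp only [ξ]
    rcases lt_or_ge (j : ℕ) (valuesUpTo ms r (size w.1)).length with hj | hj
    · rw [List.getD_eq_getElem _ _ hj]
      exact built_of_mem_valuesUpTo hr (List.getElem_mem hj)
    · rw [List.getD_eq_default _ _ hj]
      exact built_of_mem hr
  have hmem : ∀ l, (∀ o ∈ l, AdmissibleOp n ms Ol o) → wp l (var x) = wp l (plug w.1 (var y)) →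
      ∃ j, ξ j = wp l (var x) := by
    intro l hl hc
    obtain ⟨ws, hws, o, ho, e⟩ := H.built hl hx
    have hsub : SubAt d r (wp l (var x)) := by
      rw [hc, wp_plug, hrdef, plug_congr_of_ground hg v' (wp l (var y))]
      exact hs.subst _
    rw [e] at hsub
    obtain ⟨h1, rfl⟩ := length_le_of_subAt H.antichain
      (fun w hw => ⟨H.avoids w (hws w hw).1, (hws w hw).2⟩) hr ho hsub
    have hd := hs.add_size_le
    have h2 := mem_valuesUpTo (r := r) (fun w hw => (hws w hw).1)
      (h1.trans (le_of_add_le_left hd))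
    rw [← e] at h2
    obtain ⟨j, hj, e'⟩ := List.getElem_of_mem h2
    exact ⟨⟨j, (hj.trans_eq (length_valuesUpTo _ _ _)).trans_le hJ⟩, by
      simp only [ξ]
      rw [List.getD_eq_getElem _ _ hj, e']⟩
  -- The forms `x - ξ j` vanish together on the states where the equality holds. Those with
  -- `ξ j = X` are replaced by a condition on `y`, as the equality determines `y` from `x`.
  refine H.exists_short_of_forms hN (J := J) (fun j => if ξ j = X then
      (if h : ∃ Y, Built {w | w ∈ ms} {o | o ∈ Ol} Y ∧ X = plug w.1 Y then
        Pi.single (some ⟨y, hy⟩) 1 - Pi.single none (N h.choose : ℚ) else Pi.single none 1)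
      else Pi.single (some ⟨x, hx⟩) 1 - Pi.single none (N (ξ j) : ℚ))
    (C := fun l => wp l (var x) = wp l (plug w.1 (var y))) (fun l hl hc => ?_) h fun j => ?_
  · obtain ⟨j, hj⟩ := hmem l hl hc
    refine Finset.prod_eq_zero (Finset.mem_univ j) ?_
    by_cases hjX : ξ j = X
    · have hex : ∃ Y, Built {w | w ∈ ms} {o | o ∈ Ol} Y ∧ X = plug w.1 Y :=
        ⟨wp l (var y), H.built hl hy, by rw [← hjX, hj, hc, wp_plug]⟩
      have e : hex.choose = wp l (var y) := by
        refine plug_injective w.2 ?_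
        rw [← hex.choose_spec.2, ← wp_plug, ← hc, ← hj, hjX]
      rw [if_pos hjX, dif_pos hex, e]
      simp [dotProduct_sub, stateVec]
    · rw [if_neg hjX]
      simp [dotProduct_sub, stateVec, hj]
  · by_cases hjX : ξ j = X
    · rw [if_pos hjX]
      by_cases hex : ∃ Y, Built {w | w ∈ ms} {o | o ∈ Ol} Y ∧ X = plug w.1 Y
      · rw [dif_pos hex]
        simp only [dotProduct_sub, dotProduct_single, stateVec, mul_one, one_mul, sub_ne_zero]
        intro e
        have e := hinj _ _ (H.built hadm hy) hex.choose_spec.1 (by exact_mod_cast e)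
        exact hl (by rw [wp_plug, e]; exact hex.choose_spec.2)
      · rw [dif_neg hex]
        simp [stateVec]
    · rw [if_neg hjX]
      simp only [dotProduct_sub, dotProduct_single, stateVec, mul_one, one_mul, sub_ne_zero]
      exact fun e => hjX (hinj _ _ (hξ j) (H.built hadm hx) (by exact_mod_cast e.symm))

/-- The terms that occur in equalities: at most one variable, which is a program variable. -/
def UnaryBelow (n : ℕ) (t : Ω.Term ℕ) : Prop :=
  (∀ i, Occurs i t → i < n) ∧ ∀ i j, Occurs i t → Occurs j t → i = j

lemma UnaryBelow.arg {k : ℕ} {f : Ω.Functions k} {ts : Fin k → Ω.Term ℕ}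
    (h : UnaryBelow n (func f ts)) (i : Fin k) : UnaryBelow n (ts i) :=
  ⟨fun j hj => h.1 j ⟨i, hj⟩, fun j j' hj hj' => h.2 j j' ⟨i, hj⟩ ⟨i, hj'⟩⟩

/-- A term with one variable is a template applied to this variable. -/
lemma exists_template {t : Ω.Term ℕ} (h : ∀ i j, Occurs i t → Occurs j t → i = j) {y : ℕ}
    (hy : Occurs y t) : ∃ w : Template Ω, t = plug w.1 (var y) ∧ w.1 = t.relabel fun _ => () := by
  refine ⟨⟨t.relabel fun _ => (), occurs_relabel.2 ⟨y, hy, rfl⟩⟩, ?_, rfl⟩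
  simp only [relabel_eq_subst, plug, subst_subst]
  nth_rw 1 [← subst_var t]
  exact subst_congr fun i hi => by rw [h i y hi hy]; rfl

lemma size_relabel (t : Ω.Term α) (g : α → β) : size (t.relabel g) = size t := by
  induction t with
  | var a => simp [size, FirstOrder.Language.Term.listEncode]
  | func f ts ih => simp [size_func, ih]

lemma Admissible.exists_short_of_ne_var (H : Admissible P n ms Ol es) {J : ℕ} {x : ℕ} (hx : x < n)
    {t : Ω.Term ℕ} (ht : UnaryBelow n t) (hJ : (ms.length + 1) ^ size t ≤ J) {k u v : ℕ}
    {l : List (ℕ × Ω.Term ℕ)} (h : (u, l, v) ∈ level P es k) (hl : wp l (var x) ≠ wp l t) :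
    ∃ l', (u, l', v) ∈ level P es (P ^ 2 * ((n + 1) ^ J) ^ 2) ∧ wp l' (var x) ≠ wp l' t := by
  have hJ0 : 0 < J := (Nat.pow_pos (Nat.succ_pos _)).trans_le hJ
  by_cases hg : ∃ y, Occurs y t
  · obtain ⟨y, hy⟩ := hg
    obtain ⟨w, e, hw⟩ := exists_template ht.2 hy
    have hsz : size w.1 = size t := by rw [hw, size_relabel]
    rw [e] at hl ⊢
    by_cases hav : Avoids {o | o ∈ Ol} w.1
    · exact H.exists_short_of_ne_avoiding hJ0 hx (ht.1 y hy) hav h hl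
    · exact H.exists_short_of_ne_not_avoiding hx (ht.1 y hy) hav (hsz ▸ hJ) h hl
  · push Not at hg
    exact H.exists_short_of_ne_ground hJ0 hx (fun i _ => hg i) h hl

/-- An equality that is violated by some run is violated by a run of bounded height. Equal function
symbols at the roots of both sides are removed until one of the sides is a variable. -/
theorem Admissible.exists_short_of_ne (H : Admissible P n ms Ol es) {J L : ℕ} {s t : Ω.Term ℕ}
    (hs : UnaryBelow n s) (ht : UnaryBelow n t) (hsL : size s ≤ L) (htL : size t ≤ L)
    (hJ : (ms.length + 1) ^ L ≤ J) {k u v : ℕ} {l : List (ℕ × Ω.Term ℕ)}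
    (h : (u, l, v) ∈ level P es k) (hl : wp l s ≠ wp l t) :
    ∃ l', (u, l', v) ∈ level P es (P ^ 2 * ((n + 1) ^ J) ^ 2) ∧ wp l' s ≠ wp l' t := by
  have hpow : ∀ {m}, m ≤ L → (ms.length + 1) ^ m ≤ J :=
    fun hm => (Nat.pow_le_pow_right (Nat.succ_pos _) hm).trans hJ
  have hreach : ∃ l', (u, l', v) ∈ level P es (P ^ 2 * ((n + 1) ^ J) ^ 2) := by
    obtain ⟨l', h', -⟩ := exists_short_of_prod_ne_zero (J := J) (A := Option (Fin n)) H.target_lt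
      (fun _ => 1) 1 (fun _ => Pi.single none 1) h (by simp)
    rw [Fintype.card_option, Fintype.card_fin] at h'
    exact ⟨l', h'⟩
  induction s generalizing t with
  | var x => exact H.exists_short_of_ne_var (hs.1 x rfl) ht (hpow htL) h hl
  | @func m f ss ih =>
    cases t with
    | var y =>
      obtain ⟨l', h1, h2⟩ := H.exists_short_of_ne_var (ht.1 y rfl) hs (hpow hsL) h hl.symm
      exact ⟨l', h1, h2.symm⟩
    | @func m' g ts =>
      by_cases hm : m = m'
      · subst hm
        by_cases hfg : f = g
        · subst hfg
          have : ∃ i, wp l (ss i) ≠ wp l (ts i) := by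
            by_contra! hc
            exact hl (by rw [wp_func, wp_func]; exact congrArg _ (funext hc))
          obtain ⟨i, hi⟩ := this
          obtain ⟨l', h1, h2⟩ := ih i (hs.arg i) (ht.arg i)
            ((size_lt_func f ss i).le.trans hsL) ((size_lt_func f ts i).le.trans htL) hi
          refine ⟨l', h1, fun e => h2 ?_⟩
          rw [wp_func, wp_func] at e
          exact congrFun (func_inj e).2 i
        · refine hreach.imp fun l' h' => ⟨h', fun e => hfg ?_⟩
          rw [wp_func, wp_func] at e
          exact (func_inj e).1
      · refine hreach.imp fun l' h' => ⟨h', fun e => hm ?_⟩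
        rw [wp_func, wp_func] at e
        simp only [FirstOrder.Language.Term.func.injEq] at e
        exact e.1

end

end Herbrand

namespace Herbrand
open FirstOrder.Language.Term (var func)

/-! ### The system of runs of a program -/

/-- Presentations of programs as in `ProgCode`, with right-hand sides in an arbitrary type. -/
abbrev ProgData (T : Type) : Type :=
  ℕ × ℕ × List (ℕ × ℕ) × List ℕ × List (ℕ × (ℕ ⊕ (ℕ × T) ⊕ ℕ) × ℕ)

section Systems

variable {T T' : Type}

/-- The edges of the system of runs that arise from one edge of the program. There are two copies
of each program point: from `u` to `v` lead the same-level executions, and from `N + u` to `N + v`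
also those executions in which some called procedures have not returned. A non-deterministic
assignment chooses between the two values `a` and `b`. -/
def edgesOf (a b : T) (sr : List (ℕ × ℕ)) (N : ℕ) (e : ℕ × (ℕ ⊕ (ℕ × T) ⊕ ℕ) × ℕ) :
    List (Edge T) :=
  Sum.elim
    (fun x => [(e.1, .inl [(x, a)], e.2.2), (N + e.1, .inl [(x, a)], N + e.2.2),
      (e.1, .inl [(x, b)], e.2.2), (N + e.1, .inl [(x, b)], N + e.2.2)])
    (Sum.elim
      (fun o => [(e.1, .inl [o], e.2.2), (N + e.1, .inl [o], N + e.2.2)])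
      (fun q => [(e.1, .inr (sr.getD q (0, 0)), e.2.2),
        (N + e.1, .inr (sr.getD q (0, 0)), N + e.2.2),
        (N + e.1, .inl [], N + (sr.getD q (0, 0)).1)])) e.2.1

/-- The system of runs of a program; `at_ i` is the variable with number `i`. The variables that
come after the `n` program variables serve as the values of non-deterministic assignments. -/
def systemOf (at_ : ℕ → T) (c : ProgData T) : List (Edge T) :=
  c.2.2.2.2.flatMap (edgesOf (at_ c.1) (at_ (c.1 + 1)) c.2.2.1 c.2.2.2.1.length)

/-- The start point of the main procedure, in the copy that admits unfinished calls. -/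
def entryOf (c : ProgData T) : ℕ := c.2.2.2.1.length + (c.2.2.1.getD c.2.1 (0, 0)).1

/-- The runs of a program with a derivation of height at most `k`. -/
def runsOf (at_ : ℕ → T) (c : ProgData T) (k : ℕ) : List (Run T) :=
  level (2 * c.2.2.2.1.length) (systemOf at_ c) k

/-- Translate the right-hand sides of a list of assignments. -/
def mapOps (g : T → T') (l : List (ℕ × T)) : List (ℕ × T') := l.map (Prod.map id g)

/-- Translate the right-hand sides of a run. -/
def mapRun (g : T → T') (r : Run T) : Run T' := (r.1, mapOps g r.2.1, r.2.2)

/-- Translate the right-hand sides of an edge. -/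
def mapEdge (g : T → T') (e : Edge T) : Edge T' := (e.1, Sum.map (mapOps g) id e.2.1, e.2.2)

/-- Translate the right-hand sides of a program. -/
def mapProg (g : T → T') (c : ProgData T) : ProgData T' :=
  (c.1, c.2.1, c.2.2.1, c.2.2.2.1,
    c.2.2.2.2.map fun e => (e.1, Sum.map id (Sum.map (Prod.map id g) id) e.2.1, e.2.2))

lemma level_map (g : T → T') (P : ℕ) (es : List (Edge T)) (k : ℕ) :
    level P (es.map (mapEdge g)) k = (level P es k).map (mapRun g) := by
  induction k with
  | zero => simp [level, mapRun, mapOps]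
  | succ k ih =>
    rw [level, level, levelStep, levelStep, ih, List.map_append, List.map_flatMap,
      List.flatMap_map]
    congr 2
    funext ⟨v, st, w⟩
    rw [List.flatMap_map, List.map_flatMap]
    congr 1
    funext ⟨u, l, v'⟩
    change (if v' = v then _ else _) = _
    by_cases h : v' = v
    · rw [if_pos h, if_pos h]
      rcases st with ops | ⟨a, b⟩
      · simp [mapOps, mapRun, mapEdge]
      · simp only [mapEdge, Sum.map_inr, Sum.elim_inr, id_eq, List.map_flatMap, List.flatMap_map]
        congr 1
        funext ⟨u₂, l₂, v₂⟩
        change (if u₂ = a ∧ v₂ = b then _ else _) = _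
        by_cases h : u₂ = a ∧ v₂ = b
        · rw [if_pos h, if_pos h]
          simp [mapOps, mapRun]
        · rw [if_neg h, if_neg h]
          rfl
    · rw [if_neg h, if_neg h]
      rfl

/-- The runs can be computed with words instead of terms. -/
lemma runsOf_map (g : T → T') {at_ : ℕ → T} {at' : ℕ → T'} (h : ∀ i, g (at_ i) = at' i)
    (c : ProgData T) (k : ℕ) : runsOf at' (mapProg g c) k = (runsOf at_ c k).map (mapRun g) := by
  rw [runsOf, runsOf, ← level_map]
  congr 1
  simp only [systemOf, mapProg, List.flatMap_map, List.map_flatMap, ← h]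
  congr 1
  funext ⟨u, st, v⟩
  rcases st with x | o | q <;> simp [edgesOf, mapEdge, mapOps]

end Systems

section Programs

variable {Ω : FirstOrder.Language.{0, 0}} {n m : ℕ}

/-- A statement whose right-hand side is a term over the variables with numbers below `n`. -/
def Stmt.data : Stmt Ω n m → ℕ ⊕ (ℕ × Ω.Term ℕ) ⊕ ℕ
  | .havoc x => .inl x
  | .assign x t => .inr (.inl (x, t.relabel Fin.val))
  | .call q => .inr (.inr q)

/-- The presentation of a program in which right-hand sides are terms instead of words. -/
def Program.data (p : Program Ω) : ProgData (Ω.Term ℕ) :=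
  (p.numVars, p.main,
    List.ofFn (fun q => ((p.start q : ℕ), (p.ret q : ℕ))),
    List.ofFn (fun u => (p.procOf u : ℕ)),
    p.edges.map (fun e => ((e.1 : ℕ), e.2.1.data, (e.2.2 : ℕ))))

lemma listEncode_relabel {α β : Type} (t : Ω.Term α) (g : α → β) :
    (t.relabel g).listEncode = t.listEncode.map (Sum.map g id) := by
  induction t with
  | var a => rfl
  | func f ts ih =>
    simp [FirstOrder.Language.Term.listEncode, ih, List.map_flatMap]

lemma Program.code_eq (p : Program Ω) :
    p.code = mapProg FirstOrder.Language.Term.listEncode p.data := by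
  simp only [Program.code, mapProg, Program.data, List.map_map]
  congr 5
  funext ⟨u, st, v⟩
  cases st <;> simp [Stmt.code, Stmt.data, termCode, listEncode_relabel]

/-- The edges of the system of runs of a program. -/
def Program.system (p : Program Ω) : List (Edge (Ω.Term ℕ)) := systemOf var p.data

lemma Program.getD_procs (p : Program Ω) (q : Fin p.numProcs) :
    (List.ofFn (fun q => ((p.start q : ℕ), (p.ret q : ℕ)))).getD q (0, 0) =
      ((p.start q : ℕ), (p.ret q : ℕ)) := by
  rw [List.getD_eq_getElem _ _ (by simp)]
  simp

lemma Program.entryOf_data (p : Program Ω) :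
    entryOf p.data = p.numPoints + p.start p.main := by
  rw [entryOf, Program.data]
  simp only [p.getD_procs, List.length_ofFn]

lemma Program.runsOf_data (p : Program Ω) (k : ℕ) :
    runsOf var p.data k = level (2 * p.numPoints) p.system k := by
  simp [runsOf, Program.system, Program.data]

lemma Program.mem_system (p : Program Ω) {e : Edge (Ω.Term ℕ)} :
    e ∈ p.system ↔
      (∃ u x v, (u, Stmt.havoc x, v) ∈ p.edges ∧ ∃ j < 2,
        e = ((u : ℕ), .inl [((x : ℕ), var (p.numVars + j))], (v : ℕ)) ∨
        e = (p.numPoints + u, .inl [((x : ℕ), var (p.numVars + j))], p.numPoints + v)) ∨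
      (∃ u x t v, (u, Stmt.assign x t, v) ∈ p.edges ∧
        (e = ((u : ℕ), .inl [((x : ℕ), t.relabel Fin.val)], (v : ℕ)) ∨
        e = (p.numPoints + u, .inl [((x : ℕ), t.relabel Fin.val)], p.numPoints + v))) ∨
      (∃ u q v, (u, Stmt.call q, v) ∈ p.edges ∧
        (e = ((u : ℕ), .inr ((p.start q : ℕ), (p.ret q : ℕ)), (v : ℕ)) ∨
        e = (p.numPoints + u, .inr ((p.start q : ℕ), (p.ret q : ℕ)), p.numPoints + v) ∨
        e = (p.numPoints + u, .inl [], p.numPoints + p.start q))) := by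
  simp only [Program.system, systemOf, Program.data, List.flatMap_map, List.mem_flatMap,
    List.length_ofFn]
  constructor
  · rintro ⟨⟨u, st, v⟩, he, h⟩
    cases st with
    | havoc x =>
      refine .inl ⟨u, x, v, he, ?_⟩
      simp only [edgesOf, Stmt.data, Sum.elim_inl, List.mem_cons, List.not_mem_nil, or_false] at h
      rcases h with h | h | h | h
      · exact ⟨0, by omega, .inl h⟩
      · exact ⟨0, by omega, .inr h⟩
      · exact ⟨1, by omega, .inl h⟩
      · exact ⟨1, by omega, .inr h⟩
    | assign x t =>
      refine .inr (.inl ⟨u, x, t, v, he, ?_⟩)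
      simpa [edgesOf, Stmt.data] using h
    | call q =>
      refine .inr (.inr ⟨u, q, v, he, ?_⟩)
      simpa only [edgesOf, Stmt.data, Sum.elim_inr, List.mem_cons, List.not_mem_nil, or_false,
        p.getD_procs] using h
  · rintro (⟨u, x, v, he, j, hj, h⟩ | ⟨u, x, t, v, he, h⟩ | ⟨u, q, v, he, h⟩)
    · refine ⟨_, he, ?_⟩
      simp only [edgesOf, Stmt.data, Sum.elim_inl, List.mem_cons, List.not_mem_nil, or_false]
      obtain rfl | rfl : j = 0 ∨ j = 1 := by omega
      · exact h.elim .inl fun h => .inr (.inl h)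
      · exact h.elim (fun h => .inr (.inr (.inl h))) fun h => .inr (.inr (.inr h))
    · refine ⟨_, he, ?_⟩
      simpa [edgesOf, Stmt.data] using h
    · refine ⟨_, he, ?_⟩
      simpa only [edgesOf, Stmt.data, Sum.elim_inr, List.mem_cons, List.not_mem_nil, or_false,
        p.getD_procs] using h

end Programs

end Herbrand

namespace Herbrand
open FirstOrder.Language.Term (var func)

variable {Ω : FirstOrder.Language.{0, 0}}

/-! ### Validity in terms of symbolic runs -/

/-- The state of the variables after the assignments of `l` are executed in the state `θ`. -/
def after (l : List (ℕ × Ω.Term ℕ)) (θ : ℕ → Value Ω) : ℕ → Value Ω :=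
  fun i => (wp l (var i)).subst θ

lemma wp_subst (l : List (ℕ × Ω.Term ℕ)) (t : Ω.Term ℕ) (θ : ℕ → Value Ω) :
    (wp l t).subst θ = t.subst (after l θ) := by
  rw [wp_eq_subst, subst_subst]
  rfl

lemma after_append (l l' : List (ℕ × Ω.Term ℕ)) (θ : ℕ → Value Ω) :
    after (l ++ l') θ = after l' (after l θ) := by
  funext i
  rw [after, wp_append, wp_subst]
  rfl

/-- The part of an assignment of values that a program with `n` variables sees. -/
def restr (n : ℕ) (θ : ℕ → Value Ω) : State Ω n := fun i => θ i

lemma restr_after_single {n : ℕ} (x : Fin n) (r : Ω.Term ℕ) (θ : ℕ → Value Ω) :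
    restr n (after [((x : ℕ), r)] θ) = Function.update (restr n θ) x (r.subst θ) := by
  funext i
  have : wp [((x : ℕ), r)] (var (i : ℕ)) = if (i : ℕ) = x then r else var (i : ℕ) := rfl
  by_cases h : i = x
  · subst h
    rw [restr, after, this, if_pos rfl, Function.update_self]
  · rw [restr, after, this, if_neg (fun e => h (Fin.ext e)), Function.update_of_ne h]
    rfl

lemma eval_restr {n : ℕ} (θ : ℕ → Value Ω) (t : Ω.Term (Fin n)) :
    eval (restr n θ) t = (t.relabel Fin.val).subst θ := by
  rw [relabel_eq_subst, subst_subst]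
  rfl

lemma holds_restr_after {n : ℕ} (e : Equality Ω n) (l : List (ℕ × Ω.Term ℕ)) (θ : ℕ → Value Ω) :
    e.Holds (restr n (after l θ)) ↔ (wp l (e.lhs.relabel Fin.val)).subst θ =
      (wp l (e.rhs.relabel Fin.val)).subst θ := by
  rw [wp_subst, wp_subst, Equality.Holds, eval_restr, eval_restr]

namespace Program

variable (p : Program Ω)

/-- Every symbolic run between points of the first copy is a same-level execution for each choice of
the values, and every symbolic run between points of the second copy preserves reachability. -/
lemma sound_of_mem_level {k a b : ℕ} {l : List (ℕ × Ω.Term ℕ)}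
    (h : (a, l, b) ∈ level (2 * p.numPoints) p.system k) :
    (∀ u : Fin p.numPoints, a = u → ∃ v : Fin p.numPoints, b = v ∧
      ∀ θ, p.SameLevel u (restr _ θ) v (restr _ (after l θ))) ∧
    ∀ u : Fin p.numPoints, a = p.numPoints + u → ∃ v : Fin p.numPoints, b = p.numPoints + v ∧
      ∀ θ, p.Reaches u (restr _ θ) → p.Reaches v (restr _ (after l θ)) := by
  have hinj1 : ∀ {u v : Fin p.numPoints}, (u : ℕ) = v → u = v := Fin.ext
  have hinj2 : ∀ {u v : Fin p.numPoints}, p.numPoints + (u : ℕ) = p.numPoints + v → u = v :=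
    fun h => Fin.ext (by omega)
  have hne : ∀ {u v : Fin p.numPoints}, (u : ℕ) ≠ p.numPoints + v := by
    intro u v; omega
  refine level_induction (C := fun a l b => (∀ u : Fin p.numPoints, a = u →
    ∃ v : Fin p.numPoints, b = v ∧ ∀ θ, p.SameLevel u (restr _ θ) v (restr _ (after l θ))) ∧
    ∀ u : Fin p.numPoints, a = p.numPoints + u → ∃ v : Fin p.numPoints, b = p.numPoints + v ∧
      ∀ θ, p.Reaches u (restr _ θ) → p.Reaches v (restr _ (after l θ))) ?_ ?_ ?_ h
  · exact fun a _ => ⟨fun u hu => ⟨u, hu, fun θ => .refl _ _⟩, fun u hu => ⟨u, hu, fun θ h => h⟩⟩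
  · rintro a l b ops c ⟨h1, h2⟩ hs
    rcases p.mem_system.1 hs with ⟨v, x, w, he, j, -, e | e⟩ | ⟨v, x, t, w, he, e | e⟩ |
      ⟨v, q, w, he, e | e | e⟩ <;> simp only [Prod.mk.injEq, Sum.inl.injEq, reduceCtorEq,
        false_and, and_false] at e
    · obtain ⟨rfl, rfl, rfl⟩ := e
      refine ⟨fun u hu => ?_, fun u hu => ?_⟩
      · obtain ⟨v', hv, h⟩ := h1 u hu
        obtain rfl := hinj1 hv
        refine ⟨w, rfl, fun θ => ?_⟩
        rw [after_append, restr_after_single]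
        exact .havoc _ (h θ) he
      · obtain ⟨v', hv, h⟩ := h2 u hu
        exact absurd hv hne
    · obtain ⟨rfl, rfl, rfl⟩ := e
      refine ⟨fun u hu => ?_, fun u hu => ?_⟩
      · obtain ⟨v', hv, h⟩ := h1 u hu
        exact absurd hv.symm hne
      · obtain ⟨v', hv, h⟩ := h2 u hu
        obtain rfl := hinj2 hv
        refine ⟨w, rfl, fun θ hr => ?_⟩
        rw [after_append, restr_after_single]
        exact .havoc _ (h θ hr) he
    · obtain ⟨rfl, rfl, rfl⟩ := e
      refine ⟨fun u hu => ?_, fun u hu => ?_⟩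
      · obtain ⟨v', hv, h⟩ := h1 u hu
        obtain rfl := hinj1 hv
        refine ⟨w, rfl, fun θ => ?_⟩
        rw [after_append, restr_after_single, ← eval_restr]
        exact .assign (h θ) he
      · obtain ⟨v', hv, h⟩ := h2 u hu
        exact absurd hv hne
    · obtain ⟨rfl, rfl, rfl⟩ := e
      refine ⟨fun u hu => ?_, fun u hu => ?_⟩
      · obtain ⟨v', hv, h⟩ := h1 u hu
        exact absurd hv.symm hne
      · obtain ⟨v', hv, h⟩ := h2 u hu
        obtain rfl := hinj2 hv
        refine ⟨w, rfl, fun θ hr => ?_⟩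
        rw [after_append, restr_after_single, ← eval_restr]
        exact .assign (h θ hr) he
    · obtain ⟨rfl, rfl, rfl⟩ := e
      refine ⟨fun u hu => ?_, fun u hu => ?_⟩
      · obtain ⟨v', hv, h⟩ := h1 u hu
        exact absurd hv.symm hne
      · obtain ⟨v', hv, h⟩ := h2 u hu
        obtain rfl := hinj2 hv
        exact ⟨p.start q, rfl, fun θ hr => by rw [List.append_nil]; exact .enter (h θ hr) he⟩
  · rintro a l b a' b' l' c ⟨h1, h2⟩ hs ⟨h3, -⟩
    rcases p.mem_system.1 hs with ⟨v, x, w, he, j, -, e | e⟩ | ⟨v, x, t, w, he, e | e⟩ |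
      ⟨v, q, w, he, e | e | e⟩ <;> simp only [Prod.mk.injEq, Sum.inr.injEq, reduceCtorEq,
        false_and, and_false] at e
    · obtain ⟨rfl, ⟨rfl, rfl⟩, rfl⟩ := e
      obtain ⟨r, hr, h3⟩ := h3 _ rfl
      obtain rfl := hinj1 hr
      refine ⟨fun u hu => ?_, fun u hu => ?_⟩
      · obtain ⟨v', hv, h⟩ := h1 u hu
        obtain rfl := hinj1 hv
        refine ⟨w, rfl, fun θ => ?_⟩
        rw [after_append]
        exact .call (h θ) he (h3 _)
      · obtain ⟨v', hv, h⟩ := h2 u hu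
        exact absurd hv hne
    · obtain ⟨rfl, ⟨rfl, rfl⟩, rfl⟩ := e
      obtain ⟨r, hr, h3⟩ := h3 _ rfl
      obtain rfl := hinj1 hr
      refine ⟨fun u hu => ?_, fun u hu => ?_⟩
      · obtain ⟨v', hv, h⟩ := h1 u hu
        exact absurd hv.symm hne
      · obtain ⟨v', hv, h⟩ := h2 u hu
        obtain rfl := hinj2 hv
        refine ⟨w, rfl, fun θ hr => ?_⟩
        rw [after_append]
        exact .call (h θ hr) he (h3 _)

/-- Merge the variables with numbers at least `n` into the two variables `n` and `n + 1`. -/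
def merge (n : ℕ) (f : ℕ → Bool) (i : ℕ) : ℕ := if i < n then i else n + (f (i - n)).toNat

/-- The assignments of `l` change only the first `n` variables, and at most one variable occurs in
each right-hand side. -/
def UnaryOps (n : ℕ) (l : List (ℕ × Ω.Term ℕ)) : Prop :=
  ∀ o ∈ l, o.1 < n ∧ ∀ i j, Occurs i o.2 → Occurs j o.2 → i = j

lemma merge_relabel {n : ℕ} (f : ℕ → Bool) (t : Ω.Term (Fin n)) :
    (t.relabel Fin.val).relabel (merge n f) = t.relabel Fin.val := by
  rw [FirstOrder.Language.Term.relabel_relabel]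
  congr 1
  funext i
  simp [merge]

lemma wp_merge {n : ℕ} (f : ℕ → Bool) {l : List (ℕ × Ω.Term ℕ)} (hl : UnaryOps n l)
    (t : Ω.Term ℕ) : wp (mapOps (fun r => r.relabel (merge n f)) l) (t.relabel (merge n f)) =
      (wp l t).relabel (merge n f) := by
  induction l with
  | nil => rfl
  | cons o l ih =>
    have h := ih fun o ho => hl o (by simp [ho])
    simp only [wp, mapOps, List.map_cons, List.foldr_cons] at h ⊢
    rw [h]
    simp only [relabel_eq_subst, subst_subst]
    refine subst_congr fun i _ => ?_
    have ho := (hl o (by simp)).1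
    have : merge n f i = o.1 ↔ i = o.1 := by
      simp only [merge]
      split_ifs with hi <;> omega
    simp only [FirstOrder.Language.Term.subst, Prod.map_fst, Prod.map_snd, id_eq, this]
    split_ifs with hi
    · rfl
    · rfl

lemma occurs_wp_unique {n : ℕ} {l : List (ℕ × Ω.Term ℕ)} (hl : UnaryOps n l) {t : Ω.Term ℕ}
    (ht : ∀ i j, Occurs i t → Occurs j t → i = j) :
    ∀ i j, Occurs i (wp l t) → Occurs j (wp l t) → i = j := by
  induction l with
  | nil => exact ht
  | cons o l ih =>
    intro i j hi hj
    obtain ⟨a, ha, hi⟩ := occurs_subst.1 hi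
    obtain ⟨b, hb, hj⟩ := occurs_subst.1 hj
    obtain rfl := ih (fun o ho => hl o (by simp [ho])) a b ha hb
    split_ifs at hi hj with h
    · exact (hl o (by simp)).2 i j hi hj
    · exact hi.symm.trans hj

lemma after_ge {n : ℕ} {l : List (ℕ × Ω.Term ℕ)} (hl : UnaryOps n l) (θ : ℕ → Value Ω) {i : ℕ}
    (hi : n ≤ i) : after l θ i = θ i := by
  rw [after, wp_eq_self (n := n) fun o ho => (hl o ho).1]
  · rfl
  · intro j hj h
    have : i = j := h
    omega

/-- `l` describes executions from `u` to `v` in the first copy (`c = 0`) or the second copy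
(`c = numPoints`), however the variables of non-deterministic assignments are merged. -/
def Traces (c : ℕ) (u v : ℕ) (l : List (ℕ × Ω.Term ℕ)) : Prop :=
  ∀ f : ℕ → Bool, ∃ k, (c + u, mapOps (fun r => r.relabel (merge p.numVars f)) l, c + v) ∈
    level (2 * p.numPoints) p.system k

variable {p}

lemma traces_refl {c : ℕ} (hc : c = 0 ∨ c = p.numPoints) (u : Fin p.numPoints) :
    p.Traces c u u [] := fun _ => ⟨0, mem_level_zero.2 ⟨by omega, rfl, rfl⟩⟩

lemma Traces.ops {c u v w : ℕ} {l ops : List (ℕ × Ω.Term ℕ)} (h : p.Traces c u v l)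
    (he : ∀ f, (c + v, Sum.inl (mapOps (fun r => r.relabel (merge p.numVars f)) ops), c + w) ∈
      p.system) : p.Traces c u w (l ++ ops) := by
  intro f
  obtain ⟨k, hk⟩ := h f
  exact ⟨k + 1, mem_level_succ.2 (.inr (.inl ⟨_, _, _, hk, he f, by simp [mapOps]⟩))⟩

lemma Traces.call {c u v w a b : ℕ} {l l' : List (ℕ × Ω.Term ℕ)} (h : p.Traces c u v l)
    (he : (c + v, Sum.inr (a, b), c + w) ∈ p.system) (h' : p.Traces 0 a b l') :
    p.Traces c u w (l ++ l') := by
  intro f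
  obtain ⟨k, hk⟩ := h f
  obtain ⟨k', hk'⟩ := h' f
  simp only [Nat.zero_add] at hk'
  exact ⟨max k k' + 1, mem_level_succ.2 (.inr (.inr ⟨_, _, _, _, _,
    level_mono (le_max_left _ _) hk, he, level_mono (le_max_right _ _) hk', by simp [mapOps]⟩))⟩

lemma Traces.havoc {c : ℕ} (hc : c = 0 ∨ c = p.numPoints) {u : ℕ} {v w : Fin p.numPoints}
    {x : Fin p.numVars} {l : List (ℕ × Ω.Term ℕ)} (h : p.Traces c u v l)
    (he : (v, Stmt.havoc x, w) ∈ p.edges) (j : ℕ) :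
    p.Traces c u w (l ++ [((x : ℕ), var (p.numVars + j))]) := by
  refine h.ops fun f => p.mem_system.2 (.inl ⟨v, x, w, he, (f j).toNat, Bool.toNat_lt _, ?_⟩)
  rcases hc with rfl | rfl <;> simp [mapOps, merge]

lemma Traces.assign {c : ℕ} (hc : c = 0 ∨ c = p.numPoints) {u : ℕ} {v w : Fin p.numPoints}
    {x : Fin p.numVars} {t : Ω.Term (Fin p.numVars)} {l : List (ℕ × Ω.Term ℕ)}
    (h : p.Traces c u v l) (he : (v, Stmt.assign x t, w) ∈ p.edges) :
    p.Traces c u w (l ++ [((x : ℕ), t.relabel Fin.val)]) := by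
  refine h.ops fun f => p.mem_system.2 (.inr (.inl ⟨v, x, t, w, he, ?_⟩))
  rcases hc with rfl | rfl <;> simp only [mapOps, List.map_cons, List.map_nil,
    Prod.map_apply, id_eq, merge_relabel, Nat.zero_add, true_or, or_true]

lemma mem_system_call {c : ℕ} (hc : c = 0 ∨ c = p.numPoints) {v w : Fin p.numPoints}
    {q : Fin p.numProcs} (he : (v, Stmt.call q, w) ∈ p.edges) :
    (c + (v : ℕ), Sum.inr ((p.start q : ℕ), (p.ret q : ℕ)), c + (w : ℕ)) ∈ p.system := by
  refine p.mem_system.2 (.inr (.inr ⟨v, q, w, he, ?_⟩))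
  rcases hc with rfl | rfl <;> simp

lemma occurs_relabel_val_unique {t : Ω.Term (Fin p.numVars)} (ht : AtMostOneVar t) :
    ∀ i j, Occurs i (t.relabel Fin.val) → Occurs j (t.relabel Fin.val) → i = j := by
  intro i j hi hj
  obtain ⟨a, ha, rfl⟩ := occurs_relabel.1 hi
  obtain ⟨b, hb, rfl⟩ := occurs_relabel.1 hj
  rw [Finset.card_le_one.1 ht a (mem_varFinset.2 ha) b (mem_varFinset.2 hb)]

lemma UnaryOps.append {n : ℕ} {l l' : List (ℕ × Ω.Term ℕ)} (h : UnaryOps n l)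
    (h' : UnaryOps n l') : UnaryOps n (l ++ l') :=
  fun o ho => (List.mem_append.1 ho).elim (h o) (h' o)

lemma unaryOps_havoc {n : ℕ} (x : Fin n) (j : ℕ) :
    UnaryOps n [((x : ℕ), (var (n + j) : Ω.Term ℕ))] := by
  intro o ho
  obtain rfl := List.mem_singleton.1 ho
  exact ⟨x.2, fun i j hi hj => hi.symm.trans hj⟩

lemma unaryOps_assign {u v : Fin p.numPoints} {x : Fin p.numVars} {t : Ω.Term (Fin p.numVars)}
    (he : (u, Stmt.assign x t, v) ∈ p.edges) :
    UnaryOps p.numVars [((x : ℕ), t.relabel Fin.val)] := by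
  intro o ho
  obtain rfl := List.mem_singleton.1 ho
  exact ⟨x.2, occurs_relabel_val_unique (p.atMostOneVar _ _ _ _ he)⟩

section Completeness

/- Each value `c` is represented by the variable with number `numVars + enc c`. -/
variable {enc : Value Ω → ℕ}

/-- Each same-level execution is an instance of a list of assignments that does not depend on the
initial state. -/
lemma exists_trace_of_sameLevel {u v : Fin p.numPoints} {σ τ : State Ω p.numVars}
    (h : p.SameLevel u σ v τ) :
    ∃ l, UnaryOps p.numVars l ∧ (∀ c, c = 0 ∨ c = p.numPoints → p.Traces c u v l) ∧
      ∀ θ, restr _ θ = σ → (∀ a, θ (p.numVars + enc a) = a) → restr _ (after l θ) = τ := by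
  induction h with
  | refl u σ => exact ⟨[], by simp [UnaryOps], fun c hc => traces_refl hc u, fun θ h _ => h⟩
  | havoc a _ he ih =>
    obtain ⟨l, h1, h2, h3⟩ := ih
    refine ⟨_, h1.append (unaryOps_havoc _ (enc a)), fun c hc => (h2 c hc).havoc hc he (enc a),
      fun θ hθ hθ' => ?_⟩
    rw [after_append, restr_after_single, h3 θ hθ hθ']
    congr 1
    exact (after_ge h1 θ (Nat.le_add_right _ _)).trans (hθ' a)
  | assign _ he ih =>
    obtain ⟨l, h1, h2, h3⟩ := ih
    refine ⟨_, h1.append (unaryOps_assign he), fun c hc => (h2 c hc).assign hc he,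
      fun θ hθ hθ' => ?_⟩
    rw [after_append, restr_after_single, ← eval_restr, h3 θ hθ hθ']
  | call _ he _ ih ih' =>
    obtain ⟨l, h1, h2, h3⟩ := ih
    obtain ⟨l', h1', h2', h3'⟩ := ih'
    refine ⟨l ++ l', h1.append h1', fun c hc => (h2 c hc).call (mem_system_call hc he)
      (h2' 0 (.inl rfl)), fun θ hθ hθ' => ?_⟩
    rw [after_append]
    exact h3' _ (h3 θ hθ hθ') fun a => (after_ge h1 θ (Nat.le_add_right _ _)).trans (hθ' a)

lemma exists_trace_of_reaches {u : Fin p.numPoints} {σ : State Ω p.numVars}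
    (h : p.Reaches u σ) :
    ∃ l, UnaryOps p.numVars l ∧ p.Traces p.numPoints (p.start p.main) u l ∧
      ∃ σ₀, ∀ θ, restr p.numVars θ = σ₀ → (∀ a, θ (p.numVars + enc a) = a) →
        restr _ (after l θ) = σ := by
  induction h with
  | init σ => exact ⟨[], by simp [UnaryOps], traces_refl (.inr rfl) _, σ, fun θ h _ => h⟩
  | havoc a _ he ih =>
    obtain ⟨l, h1, h2, σ₀, h3⟩ := ih
    refine ⟨_, h1.append (unaryOps_havoc _ (enc a)), h2.havoc (.inr rfl) he (enc a), σ₀,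
      fun θ hθ hθ' => ?_⟩
    rw [after_append, restr_after_single, h3 θ hθ hθ']
    congr 1
    exact (after_ge h1 θ (Nat.le_add_right _ _)).trans (hθ' a)
  | assign _ he ih =>
    obtain ⟨l, h1, h2, σ₀, h3⟩ := ih
    refine ⟨_, h1.append (unaryOps_assign he), h2.assign (.inr rfl) he, σ₀, fun θ hθ hθ' => ?_⟩
    rw [after_append, restr_after_single, ← eval_restr, h3 θ hθ hθ']
  | enter _ he ih =>
    obtain ⟨l, h1, h2, σ₀, h3⟩ := ih
    refine ⟨l ++ [], by simpa using h1, h2.ops fun f => p.mem_system.2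
      (.inr (.inr ⟨_, _, _, he, .inr (.inr rfl)⟩)), σ₀, by simpa using h3⟩
  | call _ he hq ih =>
    obtain ⟨l, h1, h2, σ₀, h3⟩ := ih
    obtain ⟨l', h1', h2', h3'⟩ := exists_trace_of_sameLevel (enc := enc) hq
    refine ⟨l ++ l', h1.append h1', h2.call (mem_system_call (.inr rfl) he) (h2' 0 (.inl rfl)),
      σ₀, fun θ hθ hθ' => ?_⟩
    rw [after_append]
    exact h3' _ (h3 θ hθ hθ') fun a => (after_ge h1 θ (Nat.le_add_right _ _)).trans (hθ' a)

end Completeness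

/-- An equality is valid if and only if both sides coincide symbolically after each run. Two values
suffice for the non-deterministic assignments, since only two of the values that an execution
chooses can matter for a two-variable equality. -/
theorem validAt_iff [Countable (Value Ω)] {c d : Value Ω} (hcd : c ≠ d) (u : Fin p.numPoints)
    {e : Equality Ω p.numVars} (he : e.IsTwoVar) :
    p.ValidAt u e ↔ ∀ k l, (p.numPoints + (p.start p.main : ℕ), l, p.numPoints + (u : ℕ)) ∈
      level (2 * p.numPoints) p.system k →
        wp l (e.lhs.relabel Fin.val) = wp l (e.rhs.relabel Fin.val) := by
  classical
  constructor
  · intro h k l hl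
    by_contra hne
    obtain ⟨θ, hθ⟩ := exists_subst_ne hcd hne
    obtain ⟨v, hv, hr⟩ := (p.sound_of_mem_level hl).2 _ rfl
    obtain rfl : u = v := Fin.ext (by omega)
    exact hθ ((holds_restr_after e l θ).1 (h _ (hr θ (.init _))))
  · intro h σ hσ
    obtain ⟨enc, henc⟩ := exists_injective_nat (Value Ω)
    obtain ⟨l, h1, h2, σ₀, h3⟩ := exists_trace_of_reaches (enc := enc) hσ
    let θ : ℕ → Value Ω := fun i =>
      if hi : i < p.numVars then σ₀ ⟨i, hi⟩ else Function.extend enc id (fun _ => c) (i - p.numVars)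
    have hσ : restr _ (after l θ) = σ := by
      refine h3 θ (funext fun i => by simp [restr, θ]) fun a => ?_
      simp only [θ]
      rw [dif_neg (by omega), Nat.add_sub_cancel_left, henc.extend_apply]
      rfl
    rw [← hσ, holds_restr_after]
    congr 1
    -- the variables of non-deterministic assignments are merged according to the left-hand side
    let f : ℕ → Bool := fun j => decide (Occurs (p.numVars + j) (wp l (e.lhs.relabel Fin.val)))
    obtain ⟨k, hk⟩ := h2 f
    have heq := h k _ hk
    rw [← merge_relabel f e.lhs, ← merge_relabel f e.rhs, wp_merge f h1, wp_merge f h1] at heq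
    have hs := occurs_wp_unique h1 (occurs_relabel_val_unique he.1)
    have ht := occurs_wp_unique h1 (occurs_relabel_val_unique he.2)
    have key : ∀ a b, Occurs a (wp l (e.lhs.relabel Fin.val)) →
        Occurs b (wp l (e.rhs.relabel Fin.val)) →
        merge p.numVars f a = merge p.numVars f b → a = b := by
      intro a b ha hb hab
      simp only [merge] at hab
      split_ifs at hab with h1 h2 h2
      · exact hab
      · omega
      · omega
      · have hfa : f (a - p.numVars) = true := by
          simp only [f, decide_eq_true_eq]
          rwa [Nat.add_sub_cancel' (not_lt.1 h1)]
        have hfb : f (b - p.numVars) = true := by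
          rw [hfa] at hab
          cases hc : f (b - p.numVars)
          · rw [hc] at hab
            simp at hab
          · rfl
        simp only [f, decide_eq_true_eq] at hfb
        rw [Nat.add_sub_cancel' (not_lt.1 h2)] at hfb
        exact hs a b ha hfb
    refine relabel_injOn (fun a b ha hb hab => ?_) heq
    rcases ha with ha | ha <;> rcases hb with hb | hb
    · exact hs a b ha hb
    · exact key a b ha hb hab
    · exact (key b a hb ha hab.symm).symm
    · exact ht a b ha hb

end Program

end Herbrand

namespace Herbrand
open FirstOrder.Language.Term (var func)

variable {Ω : FirstOrder.Language.{0, 0}}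

/-! ### Initialization-restricted programs -/

/-- A ground term as a term over program variables. -/
def ofValue {n : ℕ} (c : Value Ω) : Ω.Term (Fin n) := c.relabel Empty.elim

lemma atMostOneVar_ofValue {n : ℕ} (c : Value Ω) : AtMostOneVar (ofValue c : Ω.Term (Fin n)) := by
  refine Finset.card_le_one.2 fun a ha => ?_
  obtain ⟨z, -⟩ := occurs_relabel.1 (mem_varFinset.1 ha)
  exact z.elim

lemma eval_ofValue {n : ℕ} (σ : State Ω n) (c : Value Ω) : eval σ (ofValue c) = c := by
  rw [eval, ofValue, relabel_eq_subst, subst_subst]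
  exact (subst_congr fun a => a.elim).trans (subst_var c)

namespace Program

variable (p : Program Ω)

/-- The template of a term in which some variable occurs. -/
def templateOf {n : ℕ} (t : Ω.Term (Fin n)) (h : ∃ i, Occurs i t) : Template Ω :=
  ⟨t.relabel fun _ => (), occurs_relabel.2 (h.imp fun _ h => ⟨h, rfl⟩)⟩

open Classical in
/-- The templates of the non-ground right-hand sides. -/
noncomputable def templates : List (Template Ω) :=
  p.edges.filterMap fun e => match e.2.1 with
    | .assign _ t => if h : ∃ i, Occurs i t then some (templateOf t h) else none
    | _ => none

open Classical in
/-- The values from which all other values are built: the variables of the initial state and of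
non-deterministic assignments, and the ground right-hand sides. -/
noncomputable def origins : List (Ω.Term ℕ) :=
  (List.range (p.numVars + 2)).map var ++ p.edges.filterMap fun e => match e.2.1 with
    | .assign _ t => if IsGround t then some (t.relabel Fin.val) else none
    | _ => none

lemma isGround_iff {n : ℕ} {t : Ω.Term (Fin n)} : IsGround t ↔ ∀ i, ¬ Occurs i t := by
  simp only [IsGround, Finset.eq_empty_iff_forall_notMem, mem_varFinset]

variable {p}

lemma mem_templates {w : Template Ω} : w ∈ p.templates ↔
    ∃ t ∈ p.rhs, ∃ h : ∃ i, Occurs i t, w = templateOf t h := by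
  simp only [templates, List.mem_filterMap]
  constructor
  · rintro ⟨⟨u, st, v⟩, he, h⟩
    cases st with
    | assign x t =>
      by_cases ht : ∃ i, Occurs i t
      · simp only [dif_pos ht, Option.some.injEq] at h
        exact ⟨t, ⟨u, x, v, he⟩, ht, h.symm⟩
      · simp [dif_neg ht] at h
    | havoc x => simp at h
    | call q => simp at h
  · rintro ⟨t, ⟨u, x, v, he⟩, ht, rfl⟩
    exact ⟨_, he, by simp only [dif_pos ht]⟩

lemma mem_origins {o : Ω.Term ℕ} : o ∈ p.origins ↔
    (∃ i < p.numVars + 2, o = var i) ∨ ∃ t ∈ p.groundRhs, o = t.relabel Fin.val := by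
  simp only [origins, List.mem_append, List.mem_map, List.mem_range, List.mem_filterMap]
  refine or_congr (exists_congr fun i => and_congr_right fun _ => eq_comm) ⟨?_, ?_⟩
  · rintro ⟨⟨u, st, v⟩, he, h⟩
    cases st with
    | assign x t =>
      by_cases ht : IsGround t
      · simp only [if_pos ht, Option.some.injEq] at h
        exact ⟨t, ⟨⟨u, x, v, he⟩, ht⟩, h.symm⟩
      · simp [if_neg ht] at h
    | havoc x => simp at h
    | call q => simp at h
  · rintro ⟨t, ⟨⟨u, x, v, he⟩, ht⟩, rfl⟩
    exact ⟨_, he, by simp only [if_pos ht]⟩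

lemma length_templates_le : p.templates.length ≤ p.edges.length := List.length_filterMap_le _ _

lemma relabel_val_injective {n : ℕ} {s t : Ω.Term (Fin n)}
    (h : s.relabel Fin.val = t.relabel Fin.val) : s = t :=
  relabel_injOn (fun _ _ _ _ h => Fin.ext h) h

lemma not_occurs_relabel_of_ground {n : ℕ} {t : Ω.Term (Fin n)} (h : IsGround t) (i : ℕ) :
    ¬ Occurs i (t.relabel Fin.val) := by
  rw [occurs_relabel]
  rintro ⟨a, ha, -⟩
  exact isGround_iff.1 h a ha

lemma antichain_origins (hp : p.InitRestricted) : SubtermAntichain {o | o ∈ p.origins} := by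
  intro o ho o' ho' d h
  rcases mem_origins.1 ho' with ⟨j, -, rfl⟩ | ⟨r', hr', rfl⟩
  · cases h
    rfl
  · rcases mem_origins.1 ho with ⟨i, -, rfl⟩ | ⟨r, hr, rfl⟩
    · exact absurd (h.occurs (a := i) rfl) (not_occurs_relabel_of_ground hr'.2 i)
    · obtain ⟨s, hs, e⟩ := h.of_relabel
      obtain rfl := relabel_val_injective e
      rw [hp.2 r hr r' hr' hs.subterm]

lemma avoids_templates (hp : p.InitRestricted) {w : Template Ω} (hw : w ∈ p.templates) :
    Avoids {o | o ∈ p.origins} w.1 := by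
  obtain ⟨t, ht, hvar, rfl⟩ := mem_templates.1 hw
  intro d s hs hg v hv
  obtain ⟨s, hsub, rfl⟩ := SubAt.of_relabel hs
  have hsg : IsGround s :=
    isGround_iff.2 fun i hi => hg (occurs_relabel.2 ⟨i, hi, rfl⟩)
  have e : plug (s.relabel fun _ => ()) v = s.relabel Fin.val := by
    rw [relabel_eq_subst, relabel_eq_subst, plug, subst_subst]
    exact subst_congr fun i hi => absurd hi (isGround_iff.1 hsg i)
  rw [Set.mem_ofPred_eq, e] at hv
  rcases mem_origins.1 hv with ⟨i, -, h⟩ | ⟨r, hr, h⟩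
  · cases s with
    | var j => exact isGround_iff.1 hsg j rfl
    | func f ts => simp at h
  · obtain rfl := relabel_val_injective h
    refine Set.disjoint_left.1 hp.1 hr ⟨hsg, t, ht, ?_, hsub.subterm⟩
    rw [isGround_iff]
    push Not
    exact hvar

lemma exists_eq_templateOf {t : Ω.Term (Fin p.numVars)} (ht : AtMostOneVar t) {y : Fin p.numVars}
    (hy : Occurs y t) : t.relabel Fin.val = plug (templateOf t ⟨y, hy⟩).1 (var (y : ℕ)) := by
  simp only [templateOf, relabel_eq_subst, plug, subst_subst]
  refine subst_congr fun i hi => ?_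
  rw [Finset.card_le_one.1 ht i (mem_varFinset.2 hi) y (mem_varFinset.2 hy)]
  rfl

theorem admissible (hp : p.InitRestricted) :
    Admissible (2 * p.numPoints) p.numVars p.templates p.origins p.system where
  target_lt e he := by
    rcases p.mem_system.1 he with ⟨v, x, w, he, j, -, e | e⟩ | ⟨v, x, t, w, he, e | e⟩ |
      ⟨v, q, w, he, e | e | e⟩ <;> subst e <;> simp only <;> omega
  op v ops w he o ho := by
    rcases p.mem_system.1 he with ⟨v, x, w, he, j, hj, e⟩ | ⟨v, x, t, w, he, e⟩ |
      ⟨v, q, w, he, e⟩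
    · obtain rfl : o = ((x : ℕ), var (p.numVars + j)) := by
        rcases e with e | e <;> simp only [Prod.mk.injEq, Sum.inl.injEq] at e <;>
          simpa [e.2.1] using ho
      refine ⟨x.2, .inl ⟨mem_origins.2 (.inl ⟨_, by omega, rfl⟩), fun i hi h => ?_⟩⟩
      have : p.numVars + j = i := h
      omega
    · obtain rfl : o = ((x : ℕ), t.relabel Fin.val) := by
        rcases e with e | e <;> simp only [Prod.mk.injEq, Sum.inl.injEq] at e <;>
          simpa [e.2.1] using ho
      refine ⟨x.2, ?_⟩
      by_cases ht : ∃ i, Occurs i t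
      · obtain ⟨y, hy⟩ := ht
        exact .inr ⟨y, y.2, _, mem_templates.2 ⟨t, ⟨_, _, _, he⟩, ⟨y, hy⟩, rfl⟩,
          exists_eq_templateOf (p.atMostOneVar _ _ _ _ he) hy⟩
      · push Not at ht
        have hg := isGround_iff.2 ht
        exact .inl ⟨mem_origins.2 (.inr ⟨t, ⟨⟨_, _, _, he⟩, hg⟩, rfl⟩),
          fun i _ => not_occurs_relabel_of_ground hg i⟩
    · rcases e with e | e | e <;> simp only [Prod.mk.injEq, Sum.inl.injEq, reduceCtorEq,
        false_and, and_false] at e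
      simp [e.2.1] at ho
  antichain := antichain_origins hp
  avoids w hw := avoids_templates hp hw
  var_mem i hi := mem_origins.2 (.inl ⟨i, by omega, rfl⟩)

/-- A height of derivations that suffices for equalities whose sides have size at most `L`, in
programs with `N` points, `n` variables and `E` edges. -/
def heightBound (N n E L : ℕ) : ℕ := (2 * N) ^ 2 * ((n + 1) ^ ((E + 1) ^ L)) ^ 2

lemma unaryBelow_relabel {t : Ω.Term (Fin p.numVars)} (ht : AtMostOneVar t) :
    UnaryBelow p.numVars (t.relabel Fin.val) := by
  refine ⟨fun i hi => ?_, occurs_relabel_val_unique ht⟩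
  obtain ⟨a, -, rfl⟩ := occurs_relabel.1 hi
  exact a.2

/-- In an initialization-restricted program, an equality is valid if both sides coincide after all
runs of a certain height. -/
theorem validAt_iff_bounded [Countable (Value Ω)] (hp : p.InitRestricted) {c d : Value Ω}
    (hcd : c ≠ d) (u : Fin p.numPoints) {e : Equality Ω p.numVars} (he : e.IsTwoVar) {L : ℕ}
    (hl : size e.lhs ≤ L) (hr : size e.rhs ≤ L) :
    p.ValidAt u e ↔ ∀ l, (p.numPoints + (p.start p.main : ℕ), l, p.numPoints + (u : ℕ)) ∈
      level (2 * p.numPoints) p.system (heightBound p.numPoints p.numVars p.edges.length L) →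
        wp l (e.lhs.relabel Fin.val) = wp l (e.rhs.relabel Fin.val) := by
  rw [validAt_iff hcd u he]
  refine ⟨fun h l => h _ l, fun h k l hkl => ?_⟩
  by_contra hne
  obtain ⟨l', h1, h2⟩ := (admissible hp).exists_short_of_ne
    (unaryBelow_relabel he.1) (unaryBelow_relabel he.2) ((size_relabel _ _).trans_le hl)
    ((size_relabel _ _).trans_le hr)
    (Nat.pow_le_pow_left (Nat.succ_le_succ length_templates_le) L) hkl hne
  exact h2 (h l' h1)

/-- A point that is not reached by a run of a certain height is not reached at all: otherwise the
unsatisfiable equality `c ≐ d` would be valid there. -/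
theorem exists_run_of_reaches [Countable (Value Ω)] (hp : p.InitRestricted) {c d : Value Ω}
    (hcd : c ≠ d) (u : Fin p.numPoints) {σ : State Ω p.numVars} (hσ : p.Reaches u σ) (L : ℕ)
    (hc : size c ≤ L) (hd : size d ≤ L) :
    ∃ l, (p.numPoints + (p.start p.main : ℕ), l, p.numPoints + (u : ℕ)) ∈
      level (2 * p.numPoints) p.system (heightBound p.numPoints p.numVars p.edges.length L) := by
  by_contra! hno
  have h := (validAt_iff_bounded hp hcd u (e := ⟨ofValue c, ofValue d⟩)
    ⟨atMostOneVar_ofValue c, atMostOneVar_ofValue d⟩ (L := L)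
    ((size_relabel _ _).trans_le hc) ((size_relabel _ _).trans_le hd)).2
    (fun l hl => absurd hl (hno l)) σ hσ
  rw [Equality.Holds, eval_ofValue, eval_ofValue] at h
  exact hcd h

end Program

end Herbrand

namespace Herbrand
open FirstOrder.Language.Term (var func)

/-! ### Computability of runs and words -/

section

open Primrec

variable {α T C : Type} [Primcodable α] [Primcodable T] [Primcodable C]

lemma primrec_sumElim {β γ δ : Type} [Primcodable β] [Primcodable γ] [Primcodable δ]
    {f : α → β ⊕ γ} {g : α → β → δ} {h : α → γ → δ} (hf : Primrec f) (hg : Primrec₂ g)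
    (hh : Primrec₂ h) : Primrec fun a => Sum.elim (g a) (h a) (f a) :=
  (sumCasesOn hf hg hh).of_eq fun a => by cases f a <;> rfl

lemma primrec_singleton {f : α → T} (hf : Primrec f) : Primrec fun a => [f a] :=
  list_cons.comp hf (const [])

lemma primrec_levelStep {es : α → List (Edge T)} {S : α → List (Run T)} (hes : Primrec es)
    (hS : Primrec S) : Primrec fun a => levelStep (es a) (S a) := by
  refine list_append.comp hS (list_flatMap hes (Primrec₂.mk ?_))
  refine list_flatMap (hS.comp fst) (Primrec₂.mk ?_)
  refine ite (Primrec.eq.comp (snd.comp (snd.comp snd)) (fst.comp (snd.comp fst))) ?_ (const [])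
  refine primrec_sumElim (fst.comp (snd.comp (snd.comp fst))) (Primrec₂.mk ?_) (Primrec₂.mk ?_)
  · refine primrec_singleton (pair (fst.comp (snd.comp fst)) (pair ?_ ?_))
    · exact list_append.comp (fst.comp (snd.comp (snd.comp fst))) snd
    · exact snd.comp (snd.comp (snd.comp (fst.comp fst)))
  · refine list_flatMap (hS.comp (fst.comp (fst.comp fst))) (Primrec₂.mk ?_)
    refine ite (PrimrecPred.and (Primrec.eq.comp (fst.comp snd) (fst.comp (snd.comp fst)))
      (Primrec.eq.comp (snd.comp (snd.comp snd)) (snd.comp (snd.comp fst)))) ?_ (const [])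
    refine primrec_singleton (pair (fst.comp (snd.comp (fst.comp fst))) (pair ?_ ?_))
    · exact list_append.comp (fst.comp (snd.comp (snd.comp (fst.comp fst))))
        (fst.comp (snd.comp snd))
    · exact snd.comp (snd.comp (snd.comp (fst.comp (fst.comp fst))))

lemma primrec_level {P k : α → ℕ} {es : α → List (Edge T)} (hP : Primrec P) (hes : Primrec es)
    (hk : Primrec k) : Primrec fun a => level (P a) (es a) (k a) := by
  have h0 : Primrec fun a => (List.range (P a)).map fun u => (u, ([] : List (ℕ × T)), u) :=
    list_map (list_range.comp hP) (Primrec₂.mk (pair snd (pair (const []) snd)))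
  have h1 : Primrec fun x : α × (ℕ × List (Run T)) => levelStep (es x.1) x.2.2 :=
    primrec_levelStep (hes.comp fst) (snd.comp snd)
  refine (nat_rec' hk h0 h1.to₂).of_eq fun a => ?_
  induction k a with
  | zero => rfl
  | succ k ih => rw [level, ← ih]

lemma primrec_systemOf {at_ : ℕ → T} (hat : Primrec at_) {c : α → ProgData T} (hc : Primrec c) :
    Primrec fun a => systemOf at_ (c a) := by
  have hn : Primrec fun a => (c a).1 := fst.comp hc
  have hsr : Primrec fun a => (c a).2.2.1 := fst.comp (snd.comp (snd.comp hc))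
  have hN : Primrec fun a => (c a).2.2.2.1.length :=
    list_length.comp (fst.comp (snd.comp (snd.comp (snd.comp hc))))
  have hes : Primrec fun a => (c a).2.2.2.2 := snd.comp (snd.comp (snd.comp (snd.comp hc)))
  refine list_flatMap hes (Primrec₂.mk ?_)
  have hu : Primrec fun x : α × (ℕ × (ℕ ⊕ (ℕ × T) ⊕ ℕ) × ℕ) => x.2.1 := fst.comp snd
  have hv : Primrec fun x : α × (ℕ × (ℕ ⊕ (ℕ × T) ⊕ ℕ) × ℕ) => x.2.2.2 :=
    snd.comp (snd.comp snd)
  have hNu := nat_add.comp (hN.comp fst) hu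
  have hNv := nat_add.comp (hN.comp fst) hv
  have hinl : ∀ {δ : Type} [Primcodable δ] {f : δ → List (ℕ × T)}, Primrec f →
      Primrec fun x => (Sum.inl (f x) : List (ℕ × T) ⊕ (ℕ × ℕ)) := fun hf => sumInl.comp hf
  refine primrec_sumElim (fst.comp (snd.comp snd)) (Primrec₂.mk ?_) (Primrec₂.mk ?_)
  · have h0 := hinl (primrec_singleton (pair snd (hat.comp (hn.comp (fst.comp
      (fst (α := α × (ℕ × (ℕ ⊕ (ℕ × T) ⊕ ℕ) × ℕ)) (β := ℕ)))))))
    have h1 := hinl (primrec_singleton (pair snd (hat.comp (succ.comp (hn.comp (fst.comp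
      (fst (α := α × (ℕ × (ℕ ⊕ (ℕ × T) ⊕ ℕ) × ℕ)) (β := ℕ))))))))
    exact list_cons.comp (pair (hu.comp fst) (pair h0 (hv.comp fst)))
      (list_cons.comp (pair (hNu.comp fst) (pair h0 (hNv.comp fst)))
      (list_cons.comp (pair (hu.comp fst) (pair h1 (hv.comp fst)))
      (primrec_singleton (pair (hNu.comp fst) (pair h1 (hNv.comp fst))))))
  · refine primrec_sumElim snd (Primrec₂.mk ?_) (Primrec₂.mk ?_)
    · have h0 := hinl (primrec_singleton
        (snd (α := (α × (ℕ × (ℕ ⊕ (ℕ × T) ⊕ ℕ) × ℕ)) × ((ℕ × T) ⊕ ℕ)) (β := ℕ × T)))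
      exact list_cons.comp (pair (hu.comp (fst.comp fst)) (pair h0 (hv.comp (fst.comp fst))))
        (primrec_singleton (pair (hNu.comp (fst.comp fst))
          (pair h0 (hNv.comp (fst.comp fst)))))
    · have hq : Primrec fun x : ((α × (ℕ × (ℕ ⊕ (ℕ × T) ⊕ ℕ) × ℕ)) × ((ℕ × T) ⊕ ℕ)) × ℕ =>
          (c x.1.1.1).2.2.1.getD x.2 (0, 0) :=
        (list_getD (0, 0)).comp (hsr.comp (fst.comp (fst.comp fst))) snd
      have h0 : Primrec fun x : ((α × (ℕ × (ℕ ⊕ (ℕ × T) ⊕ ℕ) × ℕ)) × ((ℕ × T) ⊕ ℕ)) × ℕ =>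
          (Sum.inr ((c x.1.1.1).2.2.1.getD x.2 (0, 0)) : List (ℕ × T) ⊕ (ℕ × ℕ)) := sumInr.comp hq
      exact list_cons.comp (pair (hu.comp (fst.comp fst)) (pair h0 (hv.comp (fst.comp fst))))
        (list_cons.comp (pair (hNu.comp (fst.comp fst)) (pair h0 (hNv.comp (fst.comp fst))))
        (primrec_singleton (pair (hNu.comp (fst.comp fst)) (pair (hinl (const []))
          (nat_add.comp (hN.comp (fst.comp (fst.comp fst))) (fst.comp hq))))))

/-- The assignments of the runs of height at most `k` that lead to the point `u` from the start of
the program. -/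
def runsTo (at_ : ℕ → T) (c : ProgData T) (u k : ℕ) : List (List (ℕ × T)) :=
  (runsOf at_ c k).flatMap fun r =>
    if r.1 = entryOf c ∧ r.2.2 = c.2.2.2.1.length + u then [r.2.1] else []

omit [Primcodable T] in
lemma mem_runsTo {at_ : ℕ → T} {c : ProgData T} {u k : ℕ} {l : List (ℕ × T)} :
    l ∈ runsTo at_ c u k ↔ (entryOf c, l, c.2.2.2.1.length + u) ∈ runsOf at_ c k := by
  simp only [runsTo, List.mem_flatMap]
  constructor
  · rintro ⟨⟨a, l', b⟩, h, hl⟩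
    simp only at hl
    split_ifs at hl with hc
    · obtain rfl := List.mem_singleton.1 hl
      exact hc.1 ▸ hc.2 ▸ h
    · simp at hl
  · exact fun h => ⟨_, h, by simp⟩

lemma primrec_runsTo {at_ : ℕ → T} (hat : Primrec at_) {c : α → ProgData T} {u k : α → ℕ}
    (hc : Primrec c) (hu : Primrec u) (hk : Primrec k) :
    Primrec fun a => runsTo at_ (c a) (u a) (k a) := by
  have hN : Primrec fun a => (c a).2.2.2.1.length :=
    list_length.comp (fst.comp (snd.comp (snd.comp (snd.comp hc))))
  have hentry : Primrec fun a => entryOf (c a) :=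
    nat_add.comp hN (fst.comp ((list_getD (0, 0)).comp (fst.comp (snd.comp (snd.comp hc)))
      (fst.comp (snd.comp hc))))
  refine list_flatMap (primrec_level (nat_mul.comp (const 2) hN) (primrec_systemOf hat hc) hk)
    (Primrec₂.mk ?_)
  exact ite (PrimrecPred.and (Primrec.eq.comp (fst.comp snd) (hentry.comp fst))
    (Primrec.eq.comp (snd.comp (snd.comp snd)) (nat_add.comp (hN.comp fst) (hu.comp fst))))
    (primrec_singleton (fst.comp (snd.comp snd))) (const [])

lemma primrec_pow {f g : α → ℕ} (hf : Primrec f) (hg : Primrec g) :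
    Primrec fun a => f a ^ g a :=
  (Primrec₂.unpaired'.1 Nat.Primrec.pow).comp hf hg

lemma primrec_heightBound {N n E L : α → ℕ} (hN : Primrec N) (hn : Primrec n) (hE : Primrec E)
    (hL : Primrec L) : Primrec fun a => Program.heightBound (N a) (n a) (E a) (L a) :=
  nat_mul.comp (primrec_pow (nat_mul.comp (const 2) hN) (const 2))
    (primrec_pow (primrec_pow (succ.comp hn) (primrec_pow (succ.comp hE) hL)) (const 2))

/-- The words over the alphabet `A` of length at most `k`. -/
def wordsUpTo (A : List C) : ℕ → List (List C)
  | 0 => [[]]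
  | k + 1 => [] :: A.flatMap fun a => (wordsUpTo A k).map (List.cons a)

omit [Primcodable C] in
lemma mem_wordsUpTo {A : List C} {k : ℕ} {l : List C} (hl : l.length ≤ k) (hA : ∀ a ∈ l, a ∈ A) :
    l ∈ wordsUpTo A k := by
  induction k generalizing l with
  | zero => simpa [wordsUpTo] using hl
  | succ k ih =>
    cases l with
    | nil => simp [wordsUpTo]
    | cons a l =>
      simp only [wordsUpTo, List.mem_cons, reduceCtorEq, false_or, List.mem_flatMap, List.mem_map]
      exact ⟨a, hA a (by simp), l, ih (by simpa using hl) fun b hb => hA b (by simp [hb]), rfl⟩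

omit [Primcodable C] in
lemma mem_of_mem_wordsUpTo {A : List C} {k : ℕ} {l : List C} (h : l ∈ wordsUpTo A k) :
    ∀ a ∈ l, a ∈ A := by
  induction k generalizing l with
  | zero =>
    obtain rfl := List.mem_singleton.1 h
    simp
  | succ k ih =>
    rcases List.mem_cons.1 h with rfl | h
    · simp
    · obtain ⟨a, ha, h⟩ := List.mem_flatMap.1 h
      obtain ⟨l, hl, rfl⟩ := List.mem_map.1 h
      simpa [ha] using ih hl

lemma primrec_wordsUpTo {A : α → List C} {k : α → ℕ} (hA : Primrec A) (hk : Primrec k) :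
    Primrec fun a => wordsUpTo (A a) (k a) := by
  have h1 : Primrec fun x : α × (ℕ × List (List C)) =>
      [] :: (A x.1).flatMap fun a => x.2.2.map (List.cons a) :=
    list_cons.comp (const []) (list_flatMap (hA.comp fst) (Primrec₂.mk
      (list_map (snd.comp (snd.comp fst)) (Primrec₂.mk (list_cons.comp (snd.comp fst) snd)))))
  refine (nat_rec' hk (const [[]]) h1.to₂).of_eq fun a => ?_
  induction k a with
  | zero => rfl
  | succ k ih => rw [wordsUpTo, ← ih]

end

section

open Primrec

variable {α : Type} [Primcodable α] {Ω : FirstOrder.Language.{0, 0}}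

/-- The weakest precondition of a word: the assignments of `l` replace variables by words. -/
def wpCode (l : List (ℕ × TermCode Ω)) (t : TermCode Ω) : TermCode Ω :=
  l.foldr (fun o t => t.flatMap
    (Sum.elim (fun i => if i = o.1 then o.2 else [.inl i]) fun f => [.inr f])) t

lemma wpCode_nil_right (l : List (ℕ × TermCode Ω)) : wpCode l [] = [] := by
  induction l with
  | nil => rfl
  | cons o l ih => simp only [wpCode, List.foldr_cons] at ih ⊢; rw [ih]; rfl

lemma wpCode_append (l : List (ℕ × TermCode Ω)) (s t : TermCode Ω) :
    wpCode l (s ++ t) = wpCode l s ++ wpCode l t := by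
  induction l with
  | nil => rfl
  | cons o l ih => simp only [wpCode, List.foldr_cons] at ih ⊢; rw [ih, List.flatMap_append]

lemma wpCode_symbol (l : List (ℕ × TermCode Ω)) (f : Sym Ω) : wpCode l [.inr f] = [.inr f] := by
  induction l with
  | nil => rfl
  | cons o l ih => simp only [wpCode, List.foldr_cons] at ih ⊢; rw [ih]; rfl

lemma wpCode_listEncode (l : List (ℕ × Ω.Term ℕ)) (t : Ω.Term ℕ) :
    wpCode (mapOps FirstOrder.Language.Term.listEncode l) t.listEncode = (wp l t).listEncode := by
  induction l with
  | nil => rfl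
  | cons o l ih =>
    simp only [wpCode, wp, mapOps, List.map_cons, List.foldr_cons] at ih ⊢
    rw [ih, listEncode_subst]
    congr 1
    funext a
    rcases a with i | f
    · simp only [Prod.map_fst, id_eq, Sum.elim_inl, Prod.map_snd]
      split_ifs <;> rfl
    · rfl

lemma listEncode_func {β : Type} {k : ℕ} (f : Ω.Functions k) (ts : Fin k → Ω.Term β) :
    (func f ts).listEncode = Sum.inr ⟨k, f⟩ ::
      (List.ofFn ts).flatMap FirstOrder.Language.Term.listEncode := by
  rw [FirstOrder.Language.Term.listEncode, List.ofFn_eq_map, List.flatMap_map]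

/-- Polish notation is prefix-free. -/
lemma listEncode_prefix (t : Ω.Term ℕ) (x : TermCode Ω) (ts : List (Ω.Term ℕ))
    (h : t.listEncode ++ x = ts.flatMap FirstOrder.Language.Term.listEncode) :
    ∃ ts', ts = t :: ts' ∧ x = ts'.flatMap FirstOrder.Language.Term.listEncode := by
  induction t generalizing x ts with
  | var i =>
    rcases ts with - | ⟨s, ts⟩
    · simp [FirstOrder.Language.Term.listEncode] at h
    · cases s with
      | var j =>
        simp only [FirstOrder.Language.Term.listEncode, List.flatMap_cons, List.cons_append,
          List.nil_append, List.cons.injEq, Sum.inl.injEq] at h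
        exact ⟨ts, by rw [h.1], h.2⟩
      | func g us => simp [FirstOrder.Language.Term.listEncode] at h
  | @func k f us ih =>
    rcases ts with - | ⟨s, ts⟩
    · simp [FirstOrder.Language.Term.listEncode] at h
    cases s with
    | var j => simp [FirstOrder.Language.Term.listEncode] at h
    | @func k' g vs =>
      have hlist : ∀ (us : List (Ω.Term ℕ)), (∀ t ∈ us, ∀ (x : TermCode Ω) (ts : List (Ω.Term ℕ)),
          t.listEncode ++ x = ts.flatMap FirstOrder.Language.Term.listEncode →
          ∃ ts', ts = t :: ts' ∧ x = ts'.flatMap FirstOrder.Language.Term.listEncode) →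
          ∀ (x : TermCode Ω) (ts : List (Ω.Term ℕ)),
          us.flatMap FirstOrder.Language.Term.listEncode ++ x =
            ts.flatMap FirstOrder.Language.Term.listEncode →
          ∃ ts', ts = us ++ ts' ∧ x = ts'.flatMap FirstOrder.Language.Term.listEncode := by
        intro us
        induction us with
        | nil => exact fun _ x ts h => ⟨ts, rfl, h⟩
        | cons u us ihu =>
          intro hus x ts h
          rw [List.flatMap_cons, List.append_assoc] at h
          obtain ⟨ts', rfl, h'⟩ := hus u (by simp) _ _ h
          obtain ⟨ts', rfl, hx⟩ := ihu (fun t ht => hus t (by simp [ht])) _ _ h'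
          exact ⟨ts', rfl, hx⟩
      rw [List.flatMap_cons, listEncode_func, listEncode_func, List.cons_append, List.cons_append,
        List.cons.injEq, Sum.inr.injEq, Sigma.mk.injEq, ← List.flatMap_append] at h
      obtain ⟨⟨rfl, h1⟩, h2⟩ := h
      obtain rfl := eq_of_heq h1
      obtain ⟨ts', e, hx⟩ := hlist (List.ofFn us) (by
        intro t ht
        obtain ⟨i, rfl⟩ := List.mem_ofFn.1 ht
        exact ih i) _ _ h2
      obtain ⟨e1, rfl⟩ := List.append_inj e (by simp)
      rw [List.ofFn_injective e1]
      exact ⟨_, rfl, hx⟩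

/-- A word in which replacing the variables by terms gives terms is itself a list of terms. -/
lemma exists_terms_of_wpCode (l : List (ℕ × Ω.Term ℕ)) (w : TermCode Ω) (ts : List (Ω.Term ℕ))
    (h : wpCode (mapOps FirstOrder.Language.Term.listEncode l) w =
      ts.flatMap FirstOrder.Language.Term.listEncode) :
    ∃ ss : List (Ω.Term ℕ), w = ss.flatMap FirstOrder.Language.Term.listEncode ∧
      ss.map (wp l) = ts := by
  induction w generalizing ts with
  | nil =>
    rw [wpCode_nil_right] at h
    refine ⟨[], rfl, ?_⟩
    rw [← FirstOrder.Language.Term.listDecode_encode_list ts, ← h]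
    rfl
  | cons a w ih =>
    rw [← List.singleton_append, wpCode_append] at h
    rcases a with i | ⟨k, f⟩
    · have hi : wpCode (mapOps FirstOrder.Language.Term.listEncode l) [.inl i] =
        (wp l (var i)).listEncode := wpCode_listEncode l (var i)
      rw [hi] at h
      obtain ⟨ts', rfl, h'⟩ := listEncode_prefix _ _ _ h
      obtain ⟨ss, rfl, rfl⟩ := ih _ h'
      exact ⟨var i :: ss, rfl, rfl⟩
    · rw [wpCode_symbol] at h
      rcases ts with - | ⟨s, ts⟩
      · simp at h
      cases s with
      | var j => simp [FirstOrder.Language.Term.listEncode] at h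
      | @func k' g vs =>
        rw [List.flatMap_cons, listEncode_func, List.cons_append, List.cons_append,
          List.cons.injEq, Sum.inr.injEq, Sigma.mk.injEq, ← List.flatMap_append] at h
        obtain ⟨⟨rfl, h1⟩, h2⟩ := h
        obtain rfl := eq_of_heq h1
        obtain ⟨ss, rfl, e⟩ := ih _ h2
        have hlen : k ≤ ss.length := by
          have := congrArg List.length e
          simp at this
          omega
        have htake : List.ofFn (fun i : Fin k => ss[i]) = ss.take k := by
          refine List.ext_getElem (by simpa using hlen) fun i h1 h2 => by simp
        rw [← List.take_append_drop k ss, List.map_append] at e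
        obtain ⟨e1, e2⟩ := List.append_inj e (by simpa using hlen)
        refine ⟨func f (fun i : Fin k => ss[i]) :: ss.drop k, ?_, ?_⟩
        · rw [List.flatMap_cons, listEncode_func, htake, List.cons_append,
            ← List.flatMap_append, List.take_append_drop]
        · rw [List.map_cons, e2, wp_func]
          congr 2
          refine List.ofFn_injective ?_
          rw [← e1, ← htake, List.map_ofFn]
          rfl

end

end Herbrand

namespace Herbrand
open FirstOrder.Language.Term (var func)

variable {Ω : FirstOrder.Language.{0, 0}}

/-! ### The test and the basis -/

/-- The number of a variable as a word. -/
def atCode (i : ℕ) : TermCode Ω := [.inl i]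

/-- The height of derivations that are inspected in order to test the equality `e`. The constant `K`
is the total size of two fixed ground terms. -/
def testHeight (K : ℕ) (c : ProgCode Ω) (e : EqCode Ω) : ℕ :=
  Program.heightBound c.2.2.2.1.length c.1 c.2.2.2.2.length (K + (e.1.length + e.2.length))

open Classical in
/-- The test whether both sides of `e` coincide after all inspected runs that lead to `u`. -/
noncomputable def testCode (K : ℕ) (x : ProgCode Ω × ℕ × EqCode Ω) : Bool :=
  decide ((runsTo atCode x.1 x.2.1 (testHeight K x.1 x.2.2)).flatMap
    (fun l => if wpCode l x.2.2.1 = wpCode l x.2.2.2 then [] else [()]) = [])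

lemma testCode_eq_true {K : ℕ} {c : ProgCode Ω} {u : ℕ} {e : EqCode Ω} :
    testCode K (c, u, e) = true ↔
      ∀ l ∈ runsTo atCode c u (testHeight K c e), wpCode l e.1 = wpCode l e.2 := by
  simp only [testCode, decide_eq_true_eq, List.flatMap_eq_nil_iff]
  refine forall₂_congr fun l _ => ?_
  split_ifs with h <;> simp [h]

open Classical in
/-- The basis that is computed from the run `l` to `u`: all equalities `x ≐ t` that pass the test,
where `t` is a word over one variable and the symbols in the value of `x` after `l`, and `t` is not
longer than that value. -/
noncomputable def basisFromRun (K : ℕ) (x : ProgCode Ω × ℕ) (l : List (ℕ × TermCode Ω)) :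
    List (EqCode Ω) :=
  (List.range x.1.1).flatMap fun i => (List.range x.1.1).flatMap fun j =>
    (wordsUpTo (.inl j :: (wpCode l [.inl i]).flatMap (Sum.elim (fun _ => []) fun f => [.inr f]))
      (wpCode l [.inl i]).length).flatMap fun t =>
        if wpCode l t = wpCode l [.inl i] ∧ testCode K (x.1, x.2, ([.inl i], t)) = true then
          [([.inl i], t)] else []

/-- The basis of all valid equalities. If the point is not reachable, it consists of the
unsatisfiable equality `cd`. -/
noncomputable def basisCode (K : ℕ) (cd : EqCode Ω) (x : ProgCode Ω × ℕ) : List (EqCode Ω) :=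
  Option.casesOn (runsTo atCode x.1 x.2 (testHeight K x.1 ([], []))).head? [cd]
    (basisFromRun K x)

section

open Primrec

variable {α : Type} [Primcodable α] [Primcodable (Sym Ω)]

lemma primrec_wpCode {l : α → List (ℕ × TermCode Ω)} {t : α → TermCode Ω} (hl : Primrec l)
    (ht : Primrec t) : Primrec fun a => wpCode (l a) (t a) := by
  refine list_foldr (h := fun (_ : α) (x : (ℕ × TermCode Ω) × TermCode Ω) =>
    x.2.flatMap (Sum.elim (fun i => if i = x.1.1 then x.1.2 else [.inl i]) fun f => [.inr f]))
    hl ht (Primrec₂.mk ?_)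
  refine list_flatMap (snd.comp snd) (Primrec₂.mk ?_)
  refine primrec_sumElim snd (Primrec₂.mk ?_) (Primrec₂.mk ?_)
  · exact ite (Primrec.eq.comp snd (fst.comp (fst.comp (snd.comp (fst.comp fst)))))
      (snd.comp (fst.comp (snd.comp (fst.comp fst)))) (primrec_singleton (sumInl.comp snd))
  · exact primrec_singleton (sumInr.comp snd)

lemma primrec_atCode : Primrec (atCode : ℕ → TermCode Ω) :=
  primrec_singleton sumInl

lemma primrec_testHeight {K : ℕ} {c : α → ProgCode Ω} {e : α → EqCode Ω} (hc : Primrec c)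
    (he : Primrec e) : Primrec fun a => testHeight K (c a) (e a) :=
  primrec_heightBound (list_length.comp (fst.comp (snd.comp (snd.comp (snd.comp hc)))))
    (fst.comp hc) (list_length.comp (snd.comp (snd.comp (snd.comp (snd.comp hc)))))
    (nat_add.comp (const K) (nat_add.comp (list_length.comp (fst.comp he))
      (list_length.comp (snd.comp he))))

lemma primrec_testCode (K : ℕ) : Primrec (testCode (Ω := Ω) K) := by
  classical
  refine (Primrec.eq.comp (list_flatMap (primrec_runsTo primrec_atCode fst (fst.comp snd)
    (primrec_testHeight fst (snd.comp snd))) (Primrec₂.mk ?_)) (const [])).decide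
  exact ite (Primrec.eq.comp (primrec_wpCode snd (fst.comp (snd.comp (snd.comp fst))))
    (primrec_wpCode snd (snd.comp (snd.comp (snd.comp fst))))) (const []) (const [()])

lemma primrec_basisFromRun (K : ℕ) : Primrec₂ (basisFromRun (Ω := Ω) K) := by
  classical
  refine Primrec₂.mk (list_flatMap (list_range.comp (fst.comp (fst.comp fst))) (Primrec₂.mk
    (list_flatMap (list_range.comp (fst.comp (fst.comp (fst.comp fst)))) (Primrec₂.mk ?_))))
  have hx : Primrec fun a : (((ProgCode Ω × ℕ) × List (ℕ × TermCode Ω)) × ℕ) × ℕ =>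
      ([Sum.inl a.1.2] : TermCode Ω) := primrec_singleton (sumInl.comp (snd.comp fst))
  have hval : Primrec fun a : (((ProgCode Ω × ℕ) × List (ℕ × TermCode Ω)) × ℕ) × ℕ =>
      wpCode a.1.1.2 [.inl a.1.2] := primrec_wpCode (snd.comp (fst.comp fst)) hx
  refine list_flatMap (primrec_wordsUpTo (list_cons.comp (sumInl.comp snd)
    (list_flatMap hval (Primrec₂.mk (primrec_sumElim snd (Primrec₂.mk (const []))
      (Primrec₂.mk (primrec_singleton (sumInr.comp snd)))))))
    (list_length.comp hval)) (Primrec₂.mk ?_)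
  have he := pair (hx.comp fst) (snd (α := (((ProgCode Ω × ℕ) × List (ℕ × TermCode Ω)) × ℕ) × ℕ)
    (β := TermCode Ω))
  exact ite (PrimrecPred.and
    (Primrec.eq.comp (primrec_wpCode (snd.comp (fst.comp (fst.comp fst))) snd) (hval.comp fst))
    (Primrec.eq.comp ((primrec_testCode K).comp
      (pair (fst.comp (fst.comp (fst.comp (fst.comp fst))))
        (pair (snd.comp (fst.comp (fst.comp (fst.comp fst)))) he))) (const true)))
    (primrec_singleton he) (const [])

lemma primrec_basisCode (K : ℕ) (cd : EqCode Ω) : Primrec (basisCode K cd) :=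
  option_casesOn (list_head?.comp (primrec_runsTo primrec_atCode fst snd
    (primrec_testHeight fst (const ([], []))))) (const [cd]) (primrec_basisFromRun K)

end

namespace Program

variable {p : Program Ω}

lemma mem_runsTo_code {u : Fin p.numPoints} {k : ℕ} {l : List (ℕ × TermCode Ω)} :
    l ∈ runsTo atCode p.code u k ↔ ∃ l', l = mapOps FirstOrder.Language.Term.listEncode l' ∧
      (p.numPoints + (p.start p.main : ℕ), l', p.numPoints + (u : ℕ)) ∈
        level (2 * p.numPoints) p.system k := by
  have h1 : entryOf p.code = p.numPoints + p.start p.main := p.entryOf_data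
  have h2 : p.code.2.2.2.1.length = p.numPoints := List.length_ofFn
  rw [mem_runsTo, h1, h2, p.code_eq, runsOf_map FirstOrder.Language.Term.listEncode (at_ := var)
    (at' := atCode) (fun _ => rfl) p.data k, p.runsOf_data,
    List.mem_map]
  constructor
  · rintro ⟨⟨a, l', b⟩, h, e⟩
    simp only [mapRun, Prod.mk.injEq] at e
    obtain ⟨rfl, rfl, rfl⟩ := e
    exact ⟨l', rfl, h⟩
  · rintro ⟨l', rfl, h⟩
    exact ⟨_, h, rfl⟩

lemma termCode_eq {n : ℕ} (t : Ω.Term (Fin n)) : termCode t = (t.relabel Fin.val).listEncode :=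
  (listEncode_relabel _ _).symm

lemma wpCode_termCode {n : ℕ} (l : List (ℕ × Ω.Term ℕ)) (t : Ω.Term (Fin n)) :
    wpCode (mapOps FirstOrder.Language.Term.listEncode l) (termCode t) =
      (wp l (t.relabel Fin.val)).listEncode := by
  rw [termCode_eq, wpCode_listEncode]

lemma testHeight_code (K : ℕ) (e : EqCode Ω) : testHeight K p.code e =
    heightBound p.numPoints p.numVars p.edges.length (K + (e.1.length + e.2.length)) := by
  simp [testHeight, Program.code]

lemma length_termCode {n : ℕ} (t : Ω.Term (Fin n)) : (termCode t).length = size t := by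
  simp [termCode, size]

theorem testCode_iff [Countable (Value Ω)] (hp : p.InitRestricted) {c d : Value Ω} (hcd : c ≠ d)
    (K : ℕ) (u : Fin p.numPoints) {e : Equality Ω p.numVars} (he : e.IsTwoVar) :
    testCode K (p.code, (u : ℕ), e.code) = true ↔ p.ValidAt u e := by
  rw [testCode_eq_true, testHeight_code, validAt_iff_bounded hp hcd u he
    (L := K + (e.code.1.length + e.code.2.length))
    (by simp only [Equality.code, length_termCode]; omega)
    (by simp only [Equality.code, length_termCode]; omega)]
  constructor
  · intro h l hl
    have := h _ (mem_runsTo_code.2 ⟨l, rfl, hl⟩)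
    simp only [Equality.code, wpCode_termCode] at this
    exact FirstOrder.Language.Term.listEncode_injective this
  · intro h l hl
    obtain ⟨l', rfl, hl'⟩ := mem_runsTo_code.1 hl
    simp only [Equality.code, wpCode_termCode, h l' hl']

end Program

/-- A two-variable equality that holds in all states of a nonempty set follows from the two-variable
equalities `x ≐ t` that hold in all these states: since it holds in some state, equal function
symbols can be removed from both sides until one of them is a variable. -/
lemma holds_of_solved {n : ℕ} {S : Set (State Ω n)} (hS : S.Nonempty) {τ : State Ω n}
    (hτ : ∀ x t, AtMostOneVar t → (∀ σ ∈ S, σ x = eval σ t) → τ x = eval τ t)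
    {s t : Ω.Term (Fin n)} (hs : AtMostOneVar s) (ht : AtMostOneVar t)
    (h : ∀ σ ∈ S, eval σ s = eval σ t) : eval τ s = eval τ t := by
  induction s generalizing t with
  | var x => exact hτ x t ht h
  | @func k f ss ih =>
    cases t with
    | var y => exact (hτ y _ hs fun σ hσ => (h σ hσ).symm).symm
    | @func k' g ts =>
      obtain ⟨σ, hσ⟩ := id hS
      have h0 := h σ hσ
      simp only [eval, FirstOrder.Language.Term.subst, FirstOrder.Language.Term.func.injEq] at h0
      obtain ⟨rfl, h0⟩ := h0
      obtain ⟨rfl, -⟩ := by simpa only [heq_eq_eq] using h0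
      have harg : ∀ {ts : Fin k → Ω.Term (Fin n)}, AtMostOneVar (func f ts) →
          ∀ i, AtMostOneVar (ts i) := fun h i =>
        (Finset.card_le_card fun a ha =>
          mem_varFinset.2 (occurs_func.2 ⟨i, mem_varFinset.1 ha⟩)).trans h
      have hi : ∀ i, eval τ (ss i) = eval τ (ts i) := fun i =>
        ih i (harg hs i) (harg ht i) fun σ hσ => congrFun (func_inj (h σ hσ)).2 i
      simp only [eval, FirstOrder.Language.Term.subst] at hi ⊢
      rw [funext hi]

end Herbrand

namespace Herbrand
open FirstOrder.Language.Term (var func)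

variable {Ω : FirstOrder.Language.{0, 0}}

/-! ### Correctness of the computed basis -/

lemma inl_mem_listEncode {α : Type} {a : α} {t : Ω.Term α} :
    Sum.inl a ∈ t.listEncode ↔ Occurs a t := by
  induction t with
  | var b => simp [FirstOrder.Language.Term.listEncode, eq_comm]
  | func f ts ih => simp [listEncode_func, ih]

lemma inr_mem_listEncode_subst {α β : Type} {f : Sym Ω} {t : Ω.Term α} (σ : α → Ω.Term β)
    (h : Sum.inr f ∈ t.listEncode) : Sum.inr f ∈ (t.subst σ).listEncode := by
  rw [listEncode_subst]
  exact List.mem_flatMap.2 ⟨_, h, by simp⟩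

lemma size_le_size_subst {α β : Type} (t : Ω.Term α) (σ : α → Ω.Term β) :
    size t ≤ size (t.subst σ) := by
  induction t with
  | var a => exact size_pos _
  | func f ts ih =>
    rw [FirstOrder.Language.Term.subst, size_func, size_func]
    exact Nat.succ_le_succ (Finset.sum_le_sum fun i _ => ih i)

lemma inr_mem_listEncode_wp {f : Sym Ω} (l : List (ℕ × Ω.Term ℕ)) {t : Ω.Term ℕ}
    (h : Sum.inr f ∈ t.listEncode) : Sum.inr f ∈ (wp l t).listEncode := by
  induction l with
  | nil => exact h
  | cons o l ih => exact inr_mem_listEncode_subst _ ih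

lemma size_le_size_wp (l : List (ℕ × Ω.Term ℕ)) (t : Ω.Term ℕ) : size t ≤ size (wp l t) := by
  induction l with
  | nil => exact le_rfl
  | cons o l ih => exact ih.trans (size_le_size_subst _ _)

lemma atMostOneVar_var {n : ℕ} (x : Fin n) : AtMostOneVar (var x : Ω.Term (Fin n)) := by
  simp [AtMostOneVar, FirstOrder.Language.Term.varFinset]

lemma termCode_ofValue {n : ℕ} (c : Value Ω) :
    termCode (ofValue c : Ω.Term (Fin n)) = (c.relabel (Empty.elim : Empty → ℕ)).listEncode := by
  rw [Program.termCode_eq, ofValue, relabel_eq_subst, relabel_eq_subst, relabel_eq_subst,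
    subst_subst]
  congr 1
  exact subst_congr fun a => a.elim

/-- The code of the equality between two ground terms. -/
def valueEqCode (c d : Value Ω) : EqCode Ω :=
  ((c.relabel (Empty.elim : Empty → ℕ)).listEncode, (d.relabel (Empty.elim : Empty → ℕ)).listEncode)

lemma equality_code_injective {n : ℕ} :
    Function.Injective (Equality.code : Equality Ω n → EqCode Ω) := by
  have h : Function.Injective (termCode : Ω.Term (Fin n) → TermCode Ω) :=
    (List.map_injective_iff.2 (Sum.map_injective.2 ⟨Fin.val_injective, fun _ _ h => h⟩)).comp
      FirstOrder.Language.Term.listEncode_injective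
  rintro ⟨s, t⟩ ⟨s', t'⟩ he
  obtain ⟨h1, h2⟩ := Prod.mk.inj he
  exact Equality.mk.injEq .. ▸ ⟨h h1, h h2⟩

namespace Program

variable {p : Program Ω}

/-- All members of the computed list are codes of valid equalities: a word that passes the test is
a term because its weakest precondition is one. -/
lemma exists_valid_of_mem_basisFromRun [Countable (Value Ω)] (hp : p.InitRestricted)
    {c d : Value Ω} (hcd : c ≠ d) (K : ℕ) (u : Fin p.numPoints) (l : List (ℕ × Ω.Term ℕ))
    {b : EqCode Ω} (hb : b ∈ basisFromRun K (p.code, (u : ℕ))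
      (mapOps FirstOrder.Language.Term.listEncode l)) :
    ∃ e : Equality Ω p.numVars, e.code = b ∧ e.IsTwoVar ∧ p.ValidAt u e := by
  simp only [basisFromRun, List.mem_flatMap, List.mem_range] at hb
  obtain ⟨i, hi, j, hj, w, hw, hb⟩ := hb
  split_ifs at hb with h
  swap
  · simp at hb
  obtain rfl := List.mem_singleton.1 hb
  have hi' : wpCode (mapOps FirstOrder.Language.Term.listEncode l) [.inl i] =
    (wp l (var i)).listEncode := wpCode_listEncode l (var i)
  obtain ⟨ss, rfl, hss⟩ := exists_terms_of_wpCode l w [wp l (var i)] (by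
    rw [h.1, hi', List.flatMap_singleton])
  obtain ⟨t, rfl, -⟩ := List.map_eq_singleton_iff.1 hss
  have ht : ∀ a, Occurs a t → a = j := by
    intro a ha
    have := mem_of_mem_wordsUpTo hw (.inl a) (by simpa using inl_mem_listEncode.2 ha)
    rcases List.mem_cons.1 this with h | h
    · exact Sum.inl.inj h
    · obtain ⟨s, -, h⟩ := List.mem_flatMap.1 h
      rcases s with s | s <;> simp at h
  have hi : i < p.numVars := hi
  obtain ⟨t', h'⟩ : ∃ t' : Ω.Term (Fin p.numVars), t' = t.relabel fun _ => ⟨j, hj⟩ := ⟨_, rfl⟩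
  have ht' : termCode t' = t.listEncode := by
    rw [termCode_eq, h', relabel_eq_subst, relabel_eq_subst, subst_subst]
    congr 1
    exact (subst_congr (τ := var) fun a ha => by simp [ht a ha]).trans (subst_var t)
  have h2 : Equality.IsTwoVar (⟨var ⟨i, hi⟩, t'⟩ : Equality Ω p.numVars) := by
    refine ⟨atMostOneVar_var _, Finset.card_le_one.2 fun a ha b hb => ?_⟩
    obtain ⟨-, -, ha⟩ := occurs_relabel.1 (mem_varFinset.1 (h' ▸ ha))
    obtain ⟨-, -, hb⟩ := occurs_relabel.1 (mem_varFinset.1 (h' ▸ hb))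
    exact ha.symm.trans hb
  have hcode : Equality.code ⟨var ⟨i, hi⟩, t'⟩ =
      ([.inl i], [t].flatMap FirstOrder.Language.Term.listEncode) := by
    rw [Equality.code, ht', List.flatMap_singleton]
    rfl
  exact ⟨_, hcode, h2, (testCode_iff hp hcd K u h2).1 (hcode ▸ h.2)⟩

/-- Every valid equality `x ≐ t` is in the computed list. -/
lemma code_mem_basisFromRun [Countable (Value Ω)] (hp : p.InitRestricted)
    {c d : Value Ω} (hcd : c ≠ d) (K : ℕ) (u : Fin p.numPoints) {k : ℕ} {l : List (ℕ × Ω.Term ℕ)}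
    (hl : (p.numPoints + (p.start p.main : ℕ), l, p.numPoints + (u : ℕ)) ∈
      level (2 * p.numPoints) p.system k) {x : Fin p.numVars} {t : Ω.Term (Fin p.numVars)}
    (ht : AtMostOneVar t) (h : p.ValidAt u ⟨var x, t⟩) :
    Equality.code ⟨var x, t⟩ ∈ basisFromRun K (p.code, (u : ℕ))
      (mapOps FirstOrder.Language.Term.listEncode l) := by
  have h2 : Equality.IsTwoVar (⟨var x, t⟩ : Equality Ω p.numVars) := ⟨atMostOneVar_var _, ht⟩
  have hwp := (validAt_iff hcd u h2).1 h _ _ hl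
  obtain ⟨y, hy⟩ : ∃ y, ∀ a, Occurs a t → a = y := by
    by_cases h0 : ∃ a, Occurs a t
    · obtain ⟨y, hy⟩ := h0
      exact ⟨y, fun a ha => Finset.card_le_one.1 ht _ (mem_varFinset.2 ha) _ (mem_varFinset.2 hy)⟩
    · exact ⟨x, fun a ha => (h0 ⟨a, ha⟩).elim⟩
  have hx : wpCode (mapOps FirstOrder.Language.Term.listEncode l) [.inl (x : ℕ)] =
    (wp l (var (x : ℕ))).listEncode := wpCode_listEncode l (var (x : ℕ))
  have hwp' : wp l (var (x : ℕ)) = wp l (t.relabel Fin.val) := hwp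
  simp only [basisFromRun, List.mem_flatMap, List.mem_range]
  refine ⟨x, x.2, y, y.2, termCode t, mem_wordsUpTo ?_ ?_, ?_⟩
  · rw [hx, hwp', termCode_eq]
    exact size_le_size_wp l _
  · rintro (a | f) ha
    · rw [termCode_eq, inl_mem_listEncode] at ha
      obtain ⟨b, hb, rfl⟩ := occurs_relabel.1 ha
      simp [hy b hb]
    · refine List.mem_cons_of_mem _ (List.mem_flatMap.2 ⟨.inr f, ?_, by simp⟩)
      rw [hx, hwp']
      exact inr_mem_listEncode_wp l (termCode_eq t ▸ ha)
  · rw [if_pos ⟨by rw [wpCode_termCode, hx, hwp'], (testCode_iff hp hcd K u h2).2 h⟩]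
    exact List.mem_singleton.2 rfl

/-- The computed list is a basis: by `holds_of_solved` it suffices that it contains the codes of all
valid equalities `x ≐ t`. -/
theorem exists_basis [Countable (Value Ω)] (hp : p.InitRestricted) {c d : Value Ω} (hcd : c ≠ d)
    (u : Fin p.numPoints) : ∃ B : List (Equality Ω p.numVars),
      B.map Equality.code = basisCode (size c + size d) (valueEqCode c d) (p.code, (u : ℕ)) ∧
      (∀ e ∈ B, e.IsTwoVar) ∧ ∀ e : Equality Ω p.numVars, e.IsTwoVar →
        (p.ValidAt u e ↔ Equality.Subsumes B e) := by
  rw [basisCode]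
  rcases hr : runsTo atCode p.code u (testHeight (size c + size d) p.code ([], [])) with - | ⟨l, ls⟩
  · -- no run within the height bound: the point is not reachable
    have hu : ∀ σ, ¬ p.Reaches u σ := by
      intro σ hσ
      obtain ⟨l, hl⟩ := exists_run_of_reaches hp hcd u hσ (size c + size d + (0 + 0)) (by omega)
        (by omega)
      have hmem := mem_runsTo_code.2 ⟨l, rfl, hl⟩
      have hh := testHeight_code (p := p) (size c + size d) ([], [])
      simp only [List.length_nil] at hh
      rw [← hh, hr] at hmem
      simp at hmem
    refine ⟨[⟨ofValue c, ofValue d⟩], ?_, ?_, fun e _ => ⟨fun _ σ hσ => ?_, fun _ σ hσ => ?_⟩⟩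
    · simp [Equality.code, termCode_ofValue, valueEqCode]
    · intro e he
      obtain rfl := List.mem_singleton.1 he
      exact ⟨atMostOneVar_ofValue c, atMostOneVar_ofValue d⟩
    · have := hσ _ (List.mem_singleton.2 rfl)
      simp only [Equality.Holds, eval_ofValue] at this
      exact (hcd this).elim
    · exact (hu σ hσ).elim
  · obtain ⟨l, rfl, hl⟩ := mem_runsTo_code.1 (hr ▸ List.mem_cons_self :
      l ∈ runsTo atCode p.code u (testHeight (size c + size d) p.code ([], [])))
    have : Nonempty (Equality Ω p.numVars) := ⟨⟨ofValue c, ofValue d⟩⟩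
    choose! f hf using fun b =>
      exists_valid_of_mem_basisFromRun hp hcd (size c + size d) u l (b := b)
    refine ⟨(basisFromRun (size c + size d) (p.code, (u : ℕ))
      (mapOps FirstOrder.Language.Term.listEncode l)).map f, ?_, ?_, fun e he => ⟨?_, ?_⟩⟩
    · rw [List.map_map]
      exact (List.map_congr_left fun b hb => (hf b hb).1).trans (List.map_id _)
    · intro e he
      obtain ⟨b, hb, rfl⟩ := List.mem_map.1 he
      exact (hf b hb).2.1
    · intro hv τ hτ
      obtain ⟨v, hv', hs⟩ := (p.sound_of_mem_level hl).2 _ rfl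
      obtain rfl : u = v := Fin.ext (by omega)
      refine holds_of_solved (S := {σ | p.Reaches u σ})
        ⟨_, hs (fun _ => c) (.init _)⟩ (fun x t ht h => ?_) he.1 he.2 hv
      have hmem := code_mem_basisFromRun hp hcd (size c + size d) u hl ht h
      have := hτ _ (List.mem_map_of_mem hmem)
      rwa [equality_code_injective (hf _ hmem).1] at this
    · intro hB σ hσ
      refine hB σ fun e he => ?_
      obtain ⟨b, hb, rfl⟩ := List.mem_map.1 he
      exact (hf b hb).2.2 σ hσ

end Program
end Herbrand

theorem mainTheorem2 (Ω : FirstOrder.Language.{0, 0}) [Primcodable (Herbrand.Sym Ω)]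
    (harity : Computable (fun f : Herbrand.Sym Ω => f.1)) (hatom : Nonempty (Ω.Functions 0)) :
    -- an algorithm that computes a finite basis of all valid equalities at a program point
    (∃ basis : Herbrand.ProgCode Ω × ℕ →. List (Herbrand.EqCode Ω), Partrec basis ∧
      ∀ p : Herbrand.Program Ω, p.InitRestricted → ∀ u : Fin p.numPoints,
        ∃ B : List (Herbrand.Equality Ω p.numVars),
          B.map Herbrand.Equality.code ∈ basis (p.code, (u : ℕ)) ∧
          (∀ e ∈ B, e.IsTwoVar) ∧
          ∀ e : Herbrand.Equality Ω p.numVars, e.IsTwoVar →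
            (p.ValidAt u e ↔ Herbrand.Equality.Subsumes B e)) ∧
    -- an algorithm that decides membership in the set of all valid equalities at a program point
    (∃ test : Herbrand.ProgCode Ω × ℕ × Herbrand.EqCode Ω →. Bool, Partrec test ∧
      ∀ p : Herbrand.Program Ω, p.InitRestricted → ∀ u : Fin p.numPoints,
        ∀ e : Herbrand.Equality Ω p.numVars, e.IsTwoVar →
          ∃ b : Bool, b ∈ test (p.code, (u : ℕ), e.code) ∧ (b = true ↔ p.ValidAt u e)) := by
  classical
  have : Encodable (Herbrand.Sym Ω) := Primcodable.toEncodable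
  have : Countable (Herbrand.Value Ω) := inferInstance
  by_cases hcd : ∃ c d : Herbrand.Value Ω, c ≠ d
  · obtain ⟨c, d, hcd⟩ := hcd
    refine ⟨⟨_, (Herbrand.primrec_basisCode (Herbrand.size c + Herbrand.size d)
      (Herbrand.valueEqCode c d)).to_comp.partrec, fun p hp u => ?_⟩, _,
      (Herbrand.primrec_testCode (Herbrand.size c + Herbrand.size d)).to_comp.partrec,
      fun p hp u e he => ⟨_, Part.mem_some _, Herbrand.Program.testCode_iff hp hcd _ u he⟩⟩
    obtain ⟨B, hB, h⟩ := Herbrand.Program.exists_basis hp hcd u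
    exact ⟨B, by rw [hB]; exact Part.mem_some _, h⟩
  · -- if there is only one value, every equality holds in every state
    have h : ∀ {n : ℕ} (σ : Herbrand.State Ω n) (e : Herbrand.Equality Ω n), e.Holds σ :=
      fun σ e => not_not.1 fun h => hcd ⟨_, _, h⟩
    exact ⟨⟨_, (Computable.const []).partrec, fun p _ u => ⟨[], Part.mem_some _, by simp,
      fun e _ => ⟨fun _ σ _ => h σ e, fun _ σ _ => h σ e⟩⟩⟩,
      _, (Computable.const true).partrec, fun p _ u e _ =>
        ⟨true, Part.mem_some _, fun _ σ _ => h σ e, fun _ => rfl⟩⟩
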